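/- Let $\alpha\in(0,2]$, $p\in(0,1)$, $d\in\mathbb N$. Let $\xi_1,\xi_2,\dots$ be i.i.d. standard isotropic $\alpha$-stable random vectors in $\mathbb R^d$, that is, $\mathbb E[e^{i\langle\theta,\xi_1\rangle}]=e^{-\|\theta\|^\alpha}$ for all $\theta\in\mathbb R^d$, where $\|\cdot\|$ is the Euclidean norm. The shark random swim with memory parameter $p$ is the process $S_n=\sum_{i=1}^n Y_i$ ($S_0=0$), where $Y_1=\xi_1$ and, for each $n\ge 2$, with probability $p$ the step $Y_n$ equals one of the past steps $Y_1,\dots,Y_{n-1}$ chosen uniformly at random, and with probability $1-p$ it is the fresh step $Y_n=\xi_n$ (all the choices being independent of each other and of the $\xi_i$). For $x\in(0,1-p)$ let $G(x)$ be a geometric random variable with parameter $q=(x/(1-p))^p$, that is, $\mathbb P(G(x)=k)=(1-q)^{k-1}q$ for $k=1,2,\dots$. Suppose $\alpha p<1$ and let $t\ge 0$. Then $\mathbb E[G(x)^\alpha]<\infty$ for all $x\in(0,1-p)$, the constant $$c(\alpha,p)=\int_0^{1-p}\mathbb E[G(x)^\alpha]\,dx$$ is finite, and, as $n\to\infty$,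 $n^{-1/\alpha}S_{\lfloor tn\rfloor}$ converges in distribution to $t^{1/\alpha}S$, where $S$ is a $d$-dimensional isotropic $\alpha$-stable random vector with zero shift and scale parameter $c(\alpha,p)^{1/\alpha}$, that is, $$\mathbb E\big[e^{i\langle\theta,S\rangle}\big]=\exp\big(-c(\alpha,p)\,\|\theta\|^\alpha\big),\qquad \theta\in\mathbb R^d.$$ (Such a random vector exists.) -/

import Mathlib

open MeasureTheory ProbabilityTheory Filter Set
open scoped Topology

noncomputable section

/-- `IsIsotropicStable α σ μ`: the probability measure `μ` on `ℝᵈ` is the law of an isotropic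
`α`-stable vector with zero shift and scale parameter `σ`, that is, its characteristic function is
`θ ↦ exp (-(σ ‖θ‖) ^ α)`. The standard case is `σ = 1`. -/
structure IsIsotropicStable {d : ℕ} (α σ : ℝ) (μ : Measure (EuclideanSpace ℝ (Fin d))) : Prop where
  isProbabilityMeasure : IsProbabilityMeasure μ
  charFun_eq : ∀ θ : EuclideanSpace ℝ (Fin d),
    charFun μ θ = Complex.exp (-(((σ * ‖θ‖) ^ α : ℝ) : ℂ))

/-- The steps of the shark random swim, built from the fresh steps `ξ`, the memory indicators `b`
and the remembered indices `u`. Steps are numbered from `0`: the first step is `ξ 0`; step `n + 1`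
repeats step `u n ∈ {0, …, n}` if `b n` is true, and is the fresh step `ξ (n + 1)` otherwise. -/
def sharkStep {E : Type*} (ξ : ℕ → E) (b : ℕ → Bool) (u : (n : ℕ) → Fin (n + 1)) : ℕ → E
  | 0 => ξ 0
  | n + 1 => if b n then sharkStep ξ b u (u n).val else ξ (n + 1)
termination_by n => n
decreasing_by exact (u n).isLt

/-- The position of the shark random swim after `n` steps. -/
def sharkPosition {E : Type*} [AddCommMonoid E] (ξ : ℕ → E) (b : ℕ → Bool)
    (u : (n : ℕ) → Fin (n + 1)) (n : ℕ) : E :=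
  ∑ i ∈ Finset.range n, sharkStep ξ b u i

/-- The randomness that drives a shark random swim with stability parameter `α` and memory
parameter `p`: the fresh steps `ξ i` are standard isotropic `α`-stable, the indicators `b n` are
Bernoulli with parameter `p`, the index `u n` is uniform on the `n + 1` past steps `0, …, n`, and
all these random variables are mutually independent. -/
structure IsSharkDriving {d : ℕ} {Ω : Type*} [MeasurableSpace Ω] (P : Measure Ω) (α p : ℝ)
    (ξ : ℕ → Ω → EuclideanSpace ℝ (Fin d)) (b : ℕ → Ω → Bool)
    (u : (n : ℕ) → Ω → Fin (n + 1)) : Prop where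
  measurable_step : ∀ i, Measurable (ξ i)
  measurable_memory : ∀ n, Measurable (b n)
  measurable_index : ∀ n, Measurable (u n)
  law_step : ∀ i, IsIsotropicStable α 1 (P.map (ξ i))
  law_memory : ∀ n, P.real {ω | b n ω = true} = p
  law_index : ∀ n (k : Fin (n + 1)), P.real {ω | u n ω = k} = 1 / ((n : ℝ) + 1)
  indep_step : iIndepFun ξ P
  indep_memory : iIndepFun b P
  indep_index : iIndepFun u P
  indep_memory_index : IndepFun (fun ω n ↦ b n ω) (fun ω n ↦ u n ω) P
  indep_step_memory_index :
    IndepFun (fun ω i ↦ ξ i ω) (fun ω ↦ ((fun n ↦ b n ω), (fun n ↦ u n ω))) P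

/-- The geometric law on `{1, 2, …}` with success probability `q ∈ [0, 1]`, giving mass
`(1 - q) ^ (k - 1) * q` to `k ≥ 1` when `q > 0`. -/
def geometricFromOne (q : unitInterval) : Measure ℕ :=
  (geometricMeasure q).map (fun k ↦ k + 1)

/-- The parameter `(x / (1 - p)) ^ p`, which lies in `(0, 1)` for `0 < p < 1` and `0 < x < 1 - p`
(outside this range it is clamped to `[0, 1]`). -/
def geometricParam (p x : ℝ) : unitInterval :=
  Set.projIcc 0 1 zero_le_one ((x / (1 - p)) ^ p)

/-- `𝔼[G ^ α]` for a geometric random variable `G` with parameter `(x / (1 - p)) ^ p`. -/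
def geometricMoment (α p x : ℝ) : ℝ :=
  ∫ k : ℕ, (k : ℝ) ^ α ∂(geometricFromOne (geometricParam p x))

/-- The constant `c(α, p) = ∫₀^{1-p} 𝔼[G(x) ^ α] dx`. -/
def sharkConstant (α p : ℝ) : ℝ :=
  ∫ x in (0 : ℝ)..(1 - p), geometricMoment α p x

end

/-! Group the first `n` steps into clusters that repeat the same fresh step. If `N i` is the size of
cluster `i`, the position is `∑ N i • ξ i`, and the sizes depend only on the memory, which is
independent of the `ξ i`. Averaging over the `ξ i` first (`charFun_sharkPosition`) gives the
characteristic function as the mean of `exp (-‖θ‖ ^ α * ∑ (N i) ^ α)`. Since `exp (-x)` is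
1-Lipschitz on `x ≥ 0`, it suffices that `(∑ (N i) ^ α) / n` converges to `c(α, p)` in `L¹`.

That law of large numbers rests on one identity. A uniformly chosen past step lies in a given
cluster with probability proportional to its size, so the mean increment of `∑ f (N i)` is `(1 - p)
* f 1` plus `p / n` times the mean of `∑ N i * (f (N i + 1) - f (N i))`
(`integral_mul_clusterSum_sub`). It is used twice. For the indicator of a single size the system is
triangular, and induction on the size gives a mean-square law with density `a k` for size `k + 1`
(`integral_sq_clusterCount_sub_le`). For `f s = s ^ β` with `β * p < 1` it gives means of order `n`
(`integral_clusterSum_rpow_le`). Because `α * p < 1`, some `β > α` is allowed, and this controls the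
large clusters uniformly in `n`.

The densities are identified by integrating the derivative of `x` times the mass at `k + 1` of the
law of `G(x)`: the integrals of these masses over `(0, 1 - p)` solve the recursion for `a`.
Exchanging sum and integral turns `∑ (k + 1) ^ α * a k` into `c(α, p)`. -/

noncomputable section

/-! ### Deterministic combinatorics of the clusters. -/

section Clusters

variable {E : Type*} (b : ℕ → Bool) (u : (n : ℕ) → Fin (n + 1))

/-- The index of the fresh step which step `n` of the swim repeats, possibly `n` itself. -/
def rootIndex : ℕ → ℕ := sharkStep id b u

lemma rootIndex_zero : rootIndex b u 0 = 0 := by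
  simp [rootIndex, sharkStep]

lemma rootIndex_succ (n : ℕ) :
    rootIndex b u (n + 1) = if b n then rootIndex b u (u n) else n + 1 := by
  simp [rootIndex, sharkStep]

lemma sharkStep_eq_rootIndex (ξ : ℕ → E) (n : ℕ) :
    sharkStep ξ b u n = ξ (rootIndex b u n) := by
  induction n using Nat.strong_induction_on with
  | _ n ih =>
    rcases n with _ | n
    · simp [rootIndex_zero, sharkStep]
    · rw [rootIndex_succ, sharkStep]
      split_ifs with h
      · exact ih _ (u n).isLt
      · rfl

lemma rootIndex_le (n : ℕ) : rootIndex b u n ≤ n := by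
  induction n using Nat.strong_induction_on with
  | _ n ih =>
    rcases n with _ | n
    · simp [rootIndex_zero]
    · rw [rootIndex_succ]
      split_ifs with h
      · exact (ih _ (u n).isLt).trans (u n).isLt.le
      · rfl

/-- The number of the first `n` steps which repeat the fresh step `i`. -/
def clusterSize (n i : ℕ) : ℕ := ((Finset.range n).filter (fun j ↦ rootIndex b u j = i)).card

/-- The sum of `f` over the sizes of the clusters formed by the first `n` steps. -/
def clusterSum (f : ℕ → ℝ) (n : ℕ) : ℝ := ∑ i ∈ Finset.range n, f (clusterSize b u n i)

lemma clusterSize_eq_zero {n i : ℕ} (h : n ≤ i) : clusterSize b u n i = 0 := by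
  rw [clusterSize, Finset.card_eq_zero, Finset.filter_eq_empty_iff]
  intro j hj hji
  have := rootIndex_le b u j
  have := Finset.mem_range.1 hj
  omega

lemma clusterSize_succ (n i : ℕ) :
    clusterSize b u (n + 1) i = clusterSize b u n i + if rootIndex b u n = i then 1 else 0 := by
  rw [clusterSize, Finset.range_add_one, Finset.filter_insert]
  split_ifs with h
  · rw [Finset.card_insert_of_notMem (by simp), clusterSize]
  · rfl

lemma clusterSize_le (n i : ℕ) : clusterSize b u n i ≤ n :=
  (Finset.card_filter_le _ _).trans (by simp)

lemma sum_comp_rootIndex [AddCommMonoid E] (ξ : ℕ → E) (n : ℕ) :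
    ∑ j ∈ Finset.range n, ξ (rootIndex b u j) =
      ∑ i ∈ Finset.range n, clusterSize b u n i • ξ i := by
  rw [← Finset.sum_fiberwise_of_maps_to (t := Finset.range n) (g := rootIndex b u)]
  · refine Finset.sum_congr rfl fun i _ ↦ ?_
    rw [clusterSize, ← Finset.sum_const]
    refine Finset.sum_congr rfl fun j hj ↦ ?_
    rw [(Finset.mem_filter.1 hj).2]
  · intro j hj
    exact Finset.mem_range.2 ((rootIndex_le b u j).trans_lt (Finset.mem_range.1 hj))

lemma sharkPosition_eq_sum_clusterSize [AddCommMonoid E] (ξ : ℕ → E) (n : ℕ) :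
    sharkPosition ξ b u n = ∑ i ∈ Finset.range n, clusterSize b u n i • ξ i := by
  simp_rw [sharkPosition, sharkStep_eq_rootIndex, sum_comp_rootIndex]

/-- Step `n` enlarges only the cluster of its own root. The condition `f 0 = 0` makes empty clusters
invisible, so a newly born cluster needs no separate case. -/
lemma clusterSum_succ {f : ℕ → ℝ} (hf : f 0 = 0) (n : ℕ) :
    clusterSum b u f (n + 1) = clusterSum b u f n +
      (f (clusterSize b u n (rootIndex b u n) + 1) - f (clusterSize b u n (rootIndex b u n))) := by
  have h : clusterSum b u f n = ∑ i ∈ Finset.range (n + 1), f (clusterSize b u n i) := by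
    rw [Finset.sum_range_succ, clusterSize_eq_zero b u le_rfl, hf, add_zero, clusterSum]
  rw [h, clusterSum, ← sub_eq_iff_eq_add', ← Finset.sum_sub_distrib,
    Finset.sum_eq_single (rootIndex b u n)]
  · rw [clusterSize_succ, if_pos rfl]
  · intro i _ hi
    rw [clusterSize_succ, if_neg hi.symm, add_zero, sub_self]
  · intro h
    exact absurd (Finset.mem_range.2 (Nat.lt_succ_of_le (rootIndex_le b u n))) h

/-- Size biasing: a cluster of size `s` is met by `s` of the past steps. -/
lemma sum_comp_clusterSize_rootIndex (g : ℕ → ℝ) (n : ℕ) :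
    ∑ j ∈ Finset.range n, g (clusterSize b u n (rootIndex b u j)) =
      clusterSum b u (fun s ↦ s * g s) n := by
  rw [sum_comp_rootIndex b u (fun i ↦ g (clusterSize b u n i)), clusterSum]
  simp

/-- The growth of a cluster sum: a fresh step creates a cluster of size one, and a repetition of
step `j` enlarges the cluster of `j`. -/
lemma clusterSum_succ_sub {f : ℕ → ℝ} (hf : f 0 = 0) (m : ℕ) :
    clusterSum b u f (m + 2) - clusterSum b u f (m + 1) =
      (if b m = false then f 1 else 0) +
      ∑ j : Fin (m + 1), (if b m = true ∧ u m = j then 1 else 0) *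
        (f (clusterSize b u (m + 1) (rootIndex b u j) + 1) -
          f (clusterSize b u (m + 1) (rootIndex b u j))) := by
  rw [clusterSum_succ b u hf (m + 1), add_sub_cancel_left, rootIndex_succ]
  cases h : b m
  · simp [clusterSize_eq_zero, hf]
  · simp

lemma clusterSum_mono_on {f g : ℕ → ℝ} {n : ℕ} (h : ∀ k ≤ n, f k ≤ g k) :
    clusterSum b u f n ≤ clusterSum b u g n :=
  Finset.sum_le_sum fun i _ ↦ h _ (clusterSize_le b u n i)

lemma clusterSum_add (f g : ℕ → ℝ) (n : ℕ) :
    clusterSum b u (fun s ↦ f s + g s) n = clusterSum b u f n + clusterSum b u g n :=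
  Finset.sum_add_distrib

lemma clusterSum_mul_left (c : ℝ) (f : ℕ → ℝ) (n : ℕ) :
    clusterSum b u (fun s ↦ c * f s) n = c * clusterSum b u f n :=
  (Finset.mul_sum _ _ _).symm

lemma clusterSum_nonneg {f : ℕ → ℝ} (h : ∀ k, 0 ≤ f k) (n : ℕ) : 0 ≤ clusterSum b u f n :=
  Finset.sum_nonneg fun _ _ ↦ h _

lemma clusterSum_const (c : ℝ) (n : ℕ) : clusterSum b u (fun _ ↦ c) n = n * c := by
  simp [clusterSum]

lemma clusterSum_one (f : ℕ → ℝ) : clusterSum b u f 1 = f 1 := by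
  simp [clusterSum, clusterSize, Finset.filter_singleton, rootIndex_zero]

lemma clusterSum_zero (f : ℕ → ℝ) : clusterSum b u f 0 = 0 := by
  simp [clusterSum]

variable {b u}

lemma rootIndex_congr {b' : ℕ → Bool} {u' : (n : ℕ) → Fin (n + 1)} {m : ℕ}
    (hb : ∀ i < m, b i = b' i) (hu : ∀ i < m, u i = u' i) :
    ∀ n ≤ m, rootIndex b u n = rootIndex b' u' n := by
  intro n
  induction n using Nat.strong_induction_on with
  | _ n ih =>
    intro hn
    rcases n with _ | n
    · simp [rootIndex_zero]
    · rw [rootIndex_succ, rootIndex_succ, hb n hn, hu n hn,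
        ih _ (u' n).isLt ((u' n).isLt.le.trans hn)]

/-- The first `m` choices determine `m + 1` steps, since step `0` is always fresh and uses no
choice. -/
lemma clusterSize_congr {b' : ℕ → Bool} {u' : (n : ℕ) → Fin (n + 1)} {m : ℕ}
    (hb : ∀ i < m, b i = b' i) (hu : ∀ i < m, u i = u' i) {n : ℕ} (hn : n ≤ m + 1) (i : ℕ) :
    clusterSize b u n i = clusterSize b' u' n i := by
  unfold clusterSize
  congr 1
  refine Finset.filter_congr fun j hj ↦ ?_
  rw [rootIndex_congr hb hu j (by have := Finset.mem_range.1 hj; omega)]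

end Clusters

/-! ### Functions of the past choices: measurability, integrability, independence. -/

section History

variable {Ω : Type*}

/-- The hypotheses factor the joint law of the four variables into its marginals, so they may be
regrouped in any pairs. -/
lemma indepFun_prodMk_prodMk [MeasurableSpace Ω] {P : Measure Ω} [IsProbabilityMeasure P]
    {A B C D : Type*} [MeasurableSpace A] [MeasurableSpace B] [MeasurableSpace C]
    [MeasurableSpace D] {f : Ω → A} {g : Ω → B} {h : Ω → C} {k : Ω → D}
    (hf : Measurable f) (hg : Measurable g) (hh : Measurable h) (hk : Measurable k)
    (hfg : IndepFun f g P) (hhk : IndepFun h k P)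
    (hpair : IndepFun (fun ω ↦ (f ω, g ω)) (fun ω ↦ (h ω, k ω)) P) :
    IndepFun (fun ω ↦ (f ω, h ω)) (fun ω ↦ (g ω, k ω)) P := by
  have hfh : IndepFun f h P := hpair.comp measurable_fst measurable_fst
  have hgk : IndepFun g k P := hpair.comp measurable_snd measurable_snd
  rw [indepFun_iff_map_prod_eq_prod_map_map (by fun_prop) (by fun_prop)]
  rw [indepFun_iff_map_prod_eq_prod_map_map (by fun_prop) (by fun_prop)] at hfg hhk hpair hfh hgk
  have : IsProbabilityMeasure (P.map f) := Measure.isProbabilityMeasure_map hf.aemeasurable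
  have : IsProbabilityMeasure (P.map g) := Measure.isProbabilityMeasure_map hg.aemeasurable
  have : IsProbabilityMeasure (P.map h) := Measure.isProbabilityMeasure_map hh.aemeasurable
  have : IsProbabilityMeasure (P.map k) := Measure.isProbabilityMeasure_map hk.aemeasurable
  rw [hfh, hgk]
  rw [hfg, hhk] at hpair
  have hshuffle : (fun ω ↦ ((f ω, h ω), (g ω, k ω))) =
      (fun x : (A × B) × (C × D) ↦ ((x.1.1, x.2.1), (x.1.2, x.2.2))) ∘
        fun ω ↦ ((f ω, g ω), (h ω, k ω)) := rfl
  rw [hshuffle, ← Measure.map_map (by fun_prop) (by fun_prop), hpair]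
  -- Both measures are compared on products of rectangles, a generating π-system.
  refine (Measure.prod_eq_generateFrom
    (C := Set.image2 (· ×ˢ ·) {s | MeasurableSet s} {s | MeasurableSet s})
    (D := Set.image2 (· ×ˢ ·) {s | MeasurableSet s} {s | MeasurableSet s})
    generateFrom_prod generateFrom_prod isPiSystem_prod isPiSystem_prod
    ⟨fun _ ↦ univ, fun _ ↦ ⟨univ, .univ, univ, .univ, by simp⟩, fun _ ↦ by simp,
      by simp [iUnion_const]⟩
    ⟨fun _ ↦ univ, fun _ ↦ ⟨univ, .univ, univ, .univ, by simp⟩, fun _ ↦ by simp,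
      by simp [iUnion_const]⟩ ?_).symm
  rintro _ ⟨s, hs, s', hs', rfl⟩ _ ⟨t, ht, t', ht', rfl⟩
  simp only [mem_ofPred_eq] at hs hs' ht ht'
  rw [Measure.map_apply (by fun_prop) ((hs.prod hs').prod (ht.prod ht'))]
  have : (fun x : (A × B) × (C × D) ↦ ((x.1.1, x.2.1), (x.1.2, x.2.2))) ⁻¹'
      ((s ×ˢ s') ×ˢ (t ×ˢ t')) = (s ×ˢ t) ×ˢ (s' ×ˢ t') := by
    ext x
    simp only [mem_preimage, mem_prod]
    tauto
  rw [this]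
  simp only [Measure.prod_prod]
  ring

/-- The first `m` memory indicators and remembered indices. -/
def sharkHistory (b : ℕ → Ω → Bool) (u : (n : ℕ) → Ω → Fin (n + 1)) (m : ℕ) (ω : Ω) :
    (Finset.range m → Bool) × ((i : Finset.range m) → Fin (i + 1)) :=
  (fun i ↦ b i ω, fun i ↦ u i ω)

variable {b : ℕ → Ω → Bool} {u : (n : ℕ) → Ω → Fin (n + 1)}

lemma measurable_sharkHistory [MeasurableSpace Ω] (hb : ∀ n, Measurable (b n))
    (hu : ∀ n, Measurable (u n)) (m : ℕ) :
    Measurable (sharkHistory b u m) := by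
  unfold sharkHistory
  fun_prop

/-- A function of the first `m` memory indicators and remembered indices. -/
def HistoryMeasurable (b : ℕ → Ω → Bool) (u : (n : ℕ) → Ω → Fin (n + 1)) {γ : Type*} (m : ℕ)
    (Z : Ω → γ) : Prop :=
  Z.FactorsThrough (sharkHistory b u m)

lemma HistoryMeasurable.exists_eq_comp {γ : Type*} [Nonempty γ] {m : ℕ} {Z : Ω → γ}
    (hZ : HistoryMeasurable b u m Z) : ∃ g, Z = g ∘ sharkHistory b u m :=
  (Function.factorsThrough_iff _).1 hZ

lemma HistoryMeasurable.measurable [MeasurableSpace Ω] {γ : Type*} [Nonempty γ]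
    [MeasurableSpace γ] {m : ℕ} {Z : Ω → γ}
    (hZ : HistoryMeasurable b u m Z) (hb : ∀ n, Measurable (b n)) (hu : ∀ n, Measurable (u n)) :
    Measurable Z := by
  obtain ⟨g, rfl⟩ := hZ.exists_eq_comp
  exact (measurable_of_countable g).comp (measurable_sharkHistory hb hu m)

/-- A history of length `m` takes finitely many values, so integrability is automatic. -/
lemma HistoryMeasurable.integrable [MeasurableSpace Ω] {m : ℕ} {Z : Ω → ℝ}
    {P : Measure Ω} [IsFiniteMeasure P]
    (hZ : HistoryMeasurable b u m Z) (hb : ∀ n, Measurable (b n)) (hu : ∀ n, Measurable (u n)) :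
    Integrable Z P := by
  obtain ⟨g, rfl⟩ := hZ.exists_eq_comp
  exact Integrable.of_finite.comp_measurable (measurable_sharkHistory hb hu m)

lemma historyMeasurable_clusterSize {m n : ℕ} (hn : n ≤ m + 1) :
    HistoryMeasurable b u m fun ω i ↦ clusterSize (b · ω) (u · ω) n i := by
  intro ω ω' h
  funext i
  refine clusterSize_congr (fun i hi ↦ ?_) (fun i hi ↦ ?_) hn i
  · exact congrFun (congrArg Prod.fst h) ⟨i, Finset.mem_range.2 hi⟩
  · exact congrFun (congrArg Prod.snd h) ⟨i, Finset.mem_range.2 hi⟩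

lemma historyMeasurable_rootIndex {m n : ℕ} (hn : n ≤ m) :
    HistoryMeasurable b u m fun ω ↦ rootIndex (b · ω) (u · ω) n := by
  intro ω ω' h
  refine rootIndex_congr (fun i hi ↦ ?_) (fun i hi ↦ ?_) n hn
  · exact congrFun (congrArg Prod.fst h) ⟨i, Finset.mem_range.2 hi⟩
  · exact congrFun (congrArg Prod.snd h) ⟨i, Finset.mem_range.2 hi⟩

lemma historyMeasurable_clusterSum {m n : ℕ} (f : ℕ → ℝ) (hn : n ≤ m + 1) :
    HistoryMeasurable b u m fun ω ↦ clusterSum (b · ω) (u · ω) f n := by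
  intro ω ω' h
  have := historyMeasurable_clusterSize hn h
  simp only [clusterSum]
  exact Finset.sum_congr rfl fun i _ ↦ congrArg f (congrFun this i)

lemma HistoryMeasurable.comp₂ {γ δ ε : Type*} {m : ℕ} {Z : Ω → γ} {W : Ω → δ}
    (hZ : HistoryMeasurable b u m Z) (hW : HistoryMeasurable b u m W) (F : γ → δ → ε) :
    HistoryMeasurable b u m fun ω ↦ F (Z ω) (W ω) :=
  fun _ _ h ↦ congrArg₂ F (hZ h) (hW h)

end History

/-! ### The mean one-step growth of cluster sums. -/

section OneStep

variable {d : ℕ} {Ω : Type*} [MeasurableSpace Ω] {P : Measure Ω} {α p : ℝ}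
  {ξ : ℕ → Ω → EuclideanSpace ℝ (Fin d)} {b : ℕ → Ω → Bool} {u : (n : ℕ) → Ω → Fin (n + 1)}

lemma IsSharkDriving.indepFun_sharkHistory [IsProbabilityMeasure P]
    (h : IsSharkDriving P α p ξ b u) (m : ℕ) :
    IndepFun (sharkHistory b u m) (fun ω ↦ (b m ω, u m ω)) P := by
  have hdisj : Disjoint (Finset.range m) {m} := by simp
  have hm : m ∈ ({m} : Finset ℕ) := Finset.mem_singleton_self m
  have h1 : IndepFun (fun ω (i : Finset.range m) ↦ b i ω) (b m) P :=
    (h.indep_memory.indepFun_finset _ _ hdisj h.measurable_memory).comp measurable_id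
      (measurable_pi_apply (⟨m, hm⟩ : ({m} : Finset ℕ)))
  have h2 : IndepFun (fun ω (i : Finset.range m) ↦ u i ω) (u m) P :=
    (h.indep_index.indepFun_finset _ _ hdisj h.measurable_index).comp measurable_id
      (measurable_pi_apply (⟨m, hm⟩ : ({m} : Finset ℕ)))
  have hb := h.measurable_memory
  have hu := h.measurable_index
  refine indepFun_prodMk_prodMk (by fun_prop) (hb m) (by fun_prop) (hu m) h1 h2 ?_
  exact h.indep_memory_index.comp
    (φ := fun x : ℕ → Bool ↦ (fun i : Finset.range m ↦ x i, x m))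
    (ψ := fun x : (n : ℕ) → Fin (n + 1) ↦ (fun i : Finset.range m ↦ x i, x m))
    (by fun_prop) (by fun_prop)

lemma IsSharkDriving.integral_mul_comp [IsProbabilityMeasure P]
    (h : IsSharkDriving P α p ξ b u) {m : ℕ} {Z : Ω → ℝ}
    (hZ : HistoryMeasurable b u m Z) (F : Bool → Fin (m + 1) → ℝ) :
    ∫ ω, Z ω * F (b m ω) (u m ω) ∂P = (∫ ω, Z ω ∂P) * ∫ ω, F (b m ω) (u m ω) ∂P := by
  obtain ⟨g, rfl⟩ := hZ.exists_eq_comp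
  exact (h.indepFun_sharkHistory m).integral_fun_comp_mul_comp (f := g)
    (g := fun x ↦ F x.1 x.2)
    (measurable_sharkHistory h.measurable_memory h.measurable_index m).aemeasurable
    ((h.measurable_memory m).prodMk (h.measurable_index m)).aemeasurable
    (measurable_of_countable _).aestronglyMeasurable
    (measurable_of_countable _).aestronglyMeasurable

lemma IsSharkDriving.integral_memory_true (h : IsSharkDriving P α p ξ b u) (m : ℕ) :
    ∫ ω, (if b m ω = true then 1 else 0 : ℝ) ∂P = p := by
  rw [← h.law_memory m, ← integral_indicator_one
    (measurableSet_eq_fun (h.measurable_memory m) measurable_const)]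
  simp only [indicator_apply, mem_ofPred_eq, Pi.one_apply]

lemma IsSharkDriving.integral_memory_false [IsProbabilityMeasure P]
    (h : IsSharkDriving P α p ξ b u) (m : ℕ) :
    ∫ ω, (if b m ω = false then 1 else 0 : ℝ) ∂P = 1 - p := by
  have hi : Integrable (fun ω ↦ (if b m ω = true then 1 else 0 : ℝ)) P :=
    HistoryMeasurable.integrable (b := b) (u := u) (m := m + 1)
      (fun ω ω' e ↦ by
        rw [show b m ω = b m ω' from
          congrFun (congrArg Prod.fst e) ⟨m, Finset.mem_range.2 m.lt_succ_self⟩])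
      h.measurable_memory h.measurable_index
  have h1 := integral_sub (integrable_const (1 : ℝ)) hi
  rw [h.integral_memory_true m, integral_const, probReal_univ, one_smul] at h1
  rw [← h1]
  congr 1
  funext ω
  cases b m ω <;> simp

lemma IsSharkDriving.integral_memory_index [IsProbabilityMeasure P]
    (h : IsSharkDriving P α p ξ b u) (m : ℕ)
    (j : Fin (m + 1)) :
    ∫ ω, (if b m ω = true ∧ u m ω = j then 1 else 0 : ℝ) ∂P = p / (m + 1) := by
  have hind : IndepFun (b m) (u m) P :=
    h.indep_memory_index.comp (measurable_pi_apply m) (measurable_pi_apply m)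
  have := hind.integral_fun_comp_mul_comp (f := fun x ↦ (if x = true then 1 else 0 : ℝ))
    (g := fun x ↦ (if x = j then 1 else 0 : ℝ)) (h.measurable_memory m).aemeasurable
    (h.measurable_index m).aemeasurable (measurable_of_countable _).aestronglyMeasurable
    (measurable_of_countable _).aestronglyMeasurable
  have hj : ∫ ω, (if u m ω = j then 1 else 0 : ℝ) ∂P = 1 / (m + 1) := by
    rw [← h.law_index m j, ← integral_indicator_one
      (measurableSet_eq_fun (h.measurable_index m) measurable_const)]
    simp only [indicator_apply, mem_ofPred_eq, Pi.one_apply]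
  rw [h.integral_memory_true m, hj] at this
  rw [div_eq_mul_one_div, ← this]
  congr 1
  funext ω
  by_cases h1 : b m ω = true <;> by_cases h2 : u m ω = j <;> simp [h1, h2]

/-- The mean growth of a cluster sum, tested against a function of the past. -/
lemma IsSharkDriving.integral_mul_clusterSum_sub [IsProbabilityMeasure P]
    (h : IsSharkDriving P α p ξ b u) {m : ℕ}
    {Z : Ω → ℝ} (hZ : HistoryMeasurable b u m Z) {f : ℕ → ℝ} (hf : f 0 = 0) :
    ∫ ω, Z ω * (clusterSum (b · ω) (u · ω) f (m + 2) - clusterSum (b · ω) (u · ω) f (m + 1)) ∂P =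
      (1 - p) * f 1 * ∫ ω, Z ω ∂P + p / (m + 1) *
        ∫ ω, Z ω * clusterSum (b · ω) (u · ω) (fun s ↦ s * (f (s + 1) - f s)) (m + 1) ∂P := by
  have hb := h.measurable_memory
  have hu := h.measurable_index
  -- The weighted growth that repeating step `j` would cause; it depends only on the first `m`
  -- choices, hence is independent of `b m` and `u m`.
  set V : Fin (m + 1) → Ω → ℝ := fun j ω ↦ Z ω *
    (f (clusterSize (b · ω) (u · ω) (m + 1) (rootIndex (b · ω) (u · ω) j) + 1) -
      f (clusterSize (b · ω) (u · ω) (m + 1) (rootIndex (b · ω) (u · ω) j))) with hV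
  have hVm : ∀ j, HistoryMeasurable b u m (V j) := fun j ↦
    hZ.comp₂ ((historyMeasurable_clusterSize le_rfl).comp₂
      (historyMeasurable_rootIndex (Nat.lt_succ_iff.1 j.isLt))
      (fun N r ↦ f (N r + 1) - f (N r))) (· * ·)
  have hmeas : ∀ (F : Bool → Fin (m + 1) → ℝ) (W : Ω → ℝ), HistoryMeasurable b u m W →
      Integrable (fun ω ↦ W ω * F (b m ω) (u m ω)) P := by
    intro F W hW
    refine HistoryMeasurable.integrable (b := b) (u := u) (m := m + 1) (fun ω ω' e ↦ ?_) hb hu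
    have hbm : b m ω = b m ω' :=
      congrFun (congrArg Prod.fst e) ⟨m, Finset.mem_range.2 m.lt_succ_self⟩
    have hum : u m ω = u m ω' :=
      congrFun (congrArg Prod.snd e) ⟨m, Finset.mem_range.2 m.lt_succ_self⟩
    have hWe : W ω = W ω' := by
      refine hW (Prod.ext (funext fun i ↦ ?_) (funext fun i ↦ ?_))
      · exact congrFun (congrArg Prod.fst e)
          ⟨i, Finset.mem_range.2 ((Finset.mem_range.1 i.2).trans m.lt_succ_self)⟩
      · exact congrFun (congrArg Prod.snd e)
          ⟨i, Finset.mem_range.2 ((Finset.mem_range.1 i.2).trans m.lt_succ_self)⟩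
    rw [hbm, hum, hWe]
  have hsplit : ∀ ω, Z ω *
      (clusterSum (b · ω) (u · ω) f (m + 2) - clusterSum (b · ω) (u · ω) f (m + 1)) =
      f 1 * (Z ω * (if b m ω = false then 1 else 0 : ℝ)) +
        ∑ j, V j ω * (if b m ω = true ∧ u m ω = j then 1 else 0 : ℝ) := by
    intro ω
    rw [clusterSum_succ_sub _ _ hf, mul_add, Finset.mul_sum]
    congr 1
    · split_ifs <;> simp [mul_comm]
    · refine Finset.sum_congr rfl fun j _ ↦ ?_
      simp only [hV]
      ring
  simp_rw [hsplit]
  rw [integral_add ((hmeas (fun x _ ↦ if x = false then 1 else 0) Z hZ).const_mul _)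
    (integrable_finsetSum _ fun j _ ↦
      hmeas (fun x y ↦ if x = true ∧ y = j then 1 else 0) _ (hVm j)), integral_const_mul,
    integral_finsetSum _ fun j _ ↦
      hmeas (fun x y ↦ if x = true ∧ y = j then 1 else 0) _ (hVm j),
    h.integral_mul_comp hZ (fun x _ ↦ if x = false then 1 else 0), h.integral_memory_false]
  simp_rw [fun j ↦ h.integral_mul_comp (hVm j) (fun x y ↦ if x = true ∧ y = j then 1 else 0),
    h.integral_memory_index]
  rw [← Finset.sum_mul, ← integral_finsetSum _ fun j _ ↦ (hVm j).integrable hb hu]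
  have hsum : ∀ ω, ∑ j, V j ω =
      Z ω * clusterSum (b · ω) (u · ω) (fun s ↦ s * (f (s + 1) - f s)) (m + 1) := by
    intro ω
    rw [← sum_comp_clusterSize_rootIndex _ _ (fun s ↦ f (s + 1) - f s), Finset.mul_sum,
      Finset.sum_range]
  simp_rw [hsum]
  ring

end OneStep

/-! ### First and second moment estimates by recursion in time. -/

section Moments

variable {d : ℕ} {Ω : Type*} [MeasurableSpace Ω] {P : Measure Ω} {α p : ℝ}
  {ξ : ℕ → Ω → EuclideanSpace ℝ (Fin d)} {b : ℕ → Ω → Bool} {u : (n : ℕ) → Ω → Fin (n + 1)}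

lemma IsSharkDriving.integrable_of_clusterSize (h : IsSharkDriving P α p ξ b u)
    [IsFiniteMeasure P] (n : ℕ) (F : (ℕ → ℕ) → ℝ) :
    Integrable (fun ω ↦ F (fun i ↦ clusterSize (b · ω) (u · ω) n i)) P :=
  HistoryMeasurable.integrable (m := n)
    (fun _ _ e ↦ congrArg F (historyMeasurable_clusterSize n.le_succ e))
    h.measurable_memory h.measurable_index

lemma IsSharkDriving.integrable_clusterSum (h : IsSharkDriving P α p ξ b u)
    [IsFiniteMeasure P] (f : ℕ → ℝ) (n : ℕ) :
    Integrable (fun ω ↦ clusterSum (b · ω) (u · ω) f n) P :=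
  h.integrable_of_clusterSize n fun N ↦ ∑ i ∈ Finset.range n, f (N i)

lemma IsSharkDriving.integrable_clusterSum_comp (h : IsSharkDriving P α p ξ b u)
    [IsFiniteMeasure P] (f : ℕ → ℝ) (n : ℕ) (F : ℝ → ℝ) :
    Integrable (fun ω ↦ F (clusterSum (b · ω) (u · ω) f n)) P :=
  h.integrable_of_clusterSize n fun N ↦ F (∑ i ∈ Finset.range n, f (N i))

lemma IsSharkDriving.p_nonneg (h : IsSharkDriving P α p ξ b u) : 0 ≤ p :=
  h.law_memory 0 ▸ measureReal_nonneg

/-- A linear drift bound for `f` gives linear growth of the mean cluster sum. -/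
lemma IsSharkDriving.integral_clusterSum_le [IsProbabilityMeasure P]
    (h : IsSharkDriving P α p ξ b u)
    {f : ℕ → ℝ} (hf : f 0 = 0) {γ C : ℝ} (hγ₀ : 0 ≤ γ) (hγ : p * γ < 1)
    (hdrift : ∀ s : ℕ, s * (f (s + 1) - f s) ≤ γ * f s + C) :
    ∃ K, ∀ n, ∫ ω, clusterSum (b · ω) (u · ω) f n ∂P ≤ K * n := by
  -- The first entry starts the induction; the second gives `(1 - p) * f 1 + p * C + p * γ * K ≤ K`,
  -- so one more step costs at most `K`.
  set K := max (f 1) (((1 - p) * f 1 + p * C) / (1 - p * γ)) with hK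
  have hK1 : f 1 ≤ K := le_max_left _ _
  have hK2 : (1 - p) * f 1 + p * C ≤ K * (1 - p * γ) :=
    (div_le_iff₀ (by linarith)).1 (le_max_right _ _)
  have hp := h.p_nonneg
  refine ⟨K, fun n ↦ ?_⟩
  rcases n with _ | n
  · simp [clusterSum_zero]
  induction n with
  | zero => simpa [clusterSum_one] using hK1
  | succ m ih =>
    have step := h.integral_mul_clusterSum_sub (m := m) (Z := fun _ ↦ 1) (fun _ _ _ ↦ rfl) hf
    simp only [one_mul, integral_const, probReal_univ, smul_eq_mul, mul_one] at step
    rw [integral_sub (h.integrable_clusterSum f _) (h.integrable_clusterSum f _)] at step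
    have hle : ∫ ω, clusterSum (b · ω) (u · ω) (fun s ↦ s * (f (s + 1) - f s)) (m + 1) ∂P ≤
        γ * ∫ ω, clusterSum (b · ω) (u · ω) f (m + 1) ∂P + (m + 1) * C := by
      rw [← integral_const_mul]
      have h1 : ∫ _, ((m : ℝ) + 1) * C ∂P = (m + 1) * C := by simp
      rw [← h1, ← integral_add ((h.integrable_clusterSum f _).const_mul _) (integrable_const _)]
      refine integral_mono (h.integrable_clusterSum _ _)
        (((h.integrable_clusterSum f _).const_mul _).add (integrable_const _)) fun ω ↦ ?_
      refine (clusterSum_mono_on _ _ fun k _ ↦ hdrift k).trans_eq ?_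
      simp only [clusterSum_add, clusterSum_mul_left, clusterSum_const]
      push_cast
      ring
    have hm : (0 : ℝ) < m + 1 := by positivity
    have hpm : 0 ≤ p / (m + 1) := by positivity
    have h2 := mul_le_mul_of_nonneg_left hle hpm
    have h3 : p / (m + 1) * (γ * ∫ ω, clusterSum (b · ω) (u · ω) f (m + 1) ∂P + (m + 1) * C) =
        p * γ / (m + 1) * ∫ ω, clusterSum (b · ω) (u · ω) f (m + 1) ∂P + p * C := by
      field_simp
    have h4 := mul_le_mul_of_nonneg_left ih (show 0 ≤ p * γ / (m + 1) by positivity)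
    have h5 : p * γ / (m + 1) * (K * ((m + 1 : ℕ) : ℝ)) = p * γ * K := by
      push_cast
      field_simp
    push_cast at ih ⊢
    linarith

/-- A mean-square law of large numbers for cluster sums, with the growth of `f` driven by `g`. -/
lemma IsSharkDriving.integral_sq_clusterSum_sub_le [IsProbabilityMeasure P]
    (h : IsSharkDriving P α p ξ b u)
    {f g : ℕ → ℝ} (hf : f 0 = 0) (hf1 : ∀ s, |f (s + 1) - f s| ≤ 1) {κ l a a' C : ℝ}
    (hκ : 0 ≤ κ) (hκl : κ ≤ l) (hfg : ∀ s : ℕ, s * (f (s + 1) - f s) = κ * g s - l * f s)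
    (ha : a = (1 - p) * f 1 + p * (κ * a' - l * a))
    (hg : ∀ n : ℕ, κ * ∫ ω, (clusterSum (b · ω) (u · ω) g n - a' * n) ^ 2 ∂P ≤ C * n) :
    ∃ K, ∀ n : ℕ, ∫ ω, (clusterSum (b · ω) (u · ω) f n - a * n) ^ 2 ∂P ≤ K * n := by
  have hp := h.p_nonneg
  have hC : 0 ≤ C := by
    have := (mul_nonneg hκ (integral_nonneg fun ω ↦ sq_nonneg _)).trans (hg 1)
    simpa using this
  have hδ : ∀ s, (f (s + 1) - f s - a) ^ 2 ≤ (1 + |a|) ^ 2 := fun s ↦ by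
    rw [sq_le_sq, abs_of_nonneg (by positivity : 0 ≤ 1 + |a|)]
    exact (abs_sub _ _).trans (by linarith [hf1 s])
  -- Cost of one step: `p * C` from the fluctuations of `g`, and `(1 + |a|) ^ 2` from the square of
  -- the centred increment.
  refine ⟨p * C + (1 + |a|) ^ 2, fun n ↦ ?_⟩
  rcases n with _ | n
  · simp [clusterSum_zero]
  induction n with
  | zero =>
    have := hδ 0
    have hpC : 0 ≤ p * C := by positivity
    simp only [zero_add, hf, sub_zero] at this
    simp only [zero_add, clusterSum_one, Nat.cast_one, mul_one, integral_const, probReal_univ,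
      smul_eq_mul, one_mul]
    linarith
  | succ m ih =>
    have hm : (0 : ℝ) < m + 1 := by positivity
    set D : Ω → ℝ := fun ω ↦ clusterSum (b · ω) (u · ω) f (m + 1) - a * (m + 1) with hD
    have hDm : HistoryMeasurable b u m D := fun _ _ e ↦
      congrArg (· - a * ((m : ℝ) + 1)) (historyMeasurable_clusterSum f le_rfl e)
    have hDi : Integrable D P := hDm.integrable h.measurable_memory h.measurable_index
    have hD2 : Integrable (fun ω ↦ D ω ^ 2) P :=
      HistoryMeasurable.integrable (m := m) (fun _ _ e ↦ congrArg (· ^ 2) (hDm e))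
        h.measurable_memory h.measurable_index
    have step := h.integral_mul_clusterSum_sub hDm hf
    have hDinc : Integrable (fun ω ↦ D ω * (clusterSum (b · ω) (u · ω) f (m + 2) -
        clusterSum (b · ω) (u · ω) f (m + 1))) P := by
      refine HistoryMeasurable.integrable (b := b) (u := u) (m := m + 1) ?_
        h.measurable_memory h.measurable_index
      intro ω ω' e
      have e1 := historyMeasurable_clusterSum f (le_refl (m + 1 + 1)) e
      have e2 := historyMeasurable_clusterSum f (Nat.le_succ (m + 1)) e
      simp only [hD] at e1 e2 ⊢
      rw [e1, e2]
    have hprod : Integrable (fun ω ↦ D ω * clusterSum (b · ω) (u · ω)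
        (fun s ↦ s * (f (s + 1) - f s)) (m + 1)) P :=
      (hDm.comp₂ (historyMeasurable_clusterSum _ le_rfl) (· * ·)).integrable
        h.measurable_memory h.measurable_index
    have hG2 : Integrable (fun ω ↦ (clusterSum (b · ω) (u · ω) g (m + 1) -
        a' * ((m + 1 : ℕ) : ℝ)) ^ 2) P :=
      h.integrable_clusterSum_comp g (m + 1) fun x ↦ (x - a' * ((m + 1 : ℕ) : ℝ)) ^ 2
    -- With `G` the centred sum of `g`, the cross term contains `κ * D * G - l * D ^ 2`. Since `κ *
    -- D * G ≤ κ / 2 * (D ^ 2 + G ^ 2)` and `κ ≤ l`, the negative term absorbs `D ^ 2`.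
    have hcross : ∫ ω, D ω * clusterSum (b · ω) (u · ω)
        (fun s ↦ s * (f (s + 1) - f s)) (m + 1) ∂P ≤
        (m + 1) * (κ * a' - l * a) * ∫ ω, D ω ∂P +
          κ / 2 * ∫ ω, (clusterSum (b · ω) (u · ω) g (m + 1) - a' * ((m + 1 : ℕ) : ℝ)) ^ 2 ∂P := by
      rw [← integral_const_mul, ← integral_const_mul,
        ← integral_add (hDi.const_mul _) (hG2.const_mul _)]
      refine integral_mono hprod ((hDi.const_mul _).add (hG2.const_mul _)) fun ω ↦ ?_
      have e : clusterSum (b · ω) (u · ω) (fun s ↦ s * (f (s + 1) - f s)) (m + 1) =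
          κ * clusterSum (b · ω) (u · ω) g (m + 1) - l * clusterSum (b · ω) (u · ω) f (m + 1) := by
        simp_rw [hfg, sub_eq_add_neg, ← neg_mul]
        rw [clusterSum_add, clusterSum_mul_left, clusterSum_mul_left]
      have e' : clusterSum (b · ω) (u · ω) f (m + 1) = D ω + a * (m + 1) := by simp [hD]
      simp only [e, e']
      set G := clusterSum (b · ω) (u · ω) g (m + 1) with hG
      push_cast
      nlinarith [mul_nonneg hκ (sq_nonneg (D ω - (G - a' * (m + 1)))),
        mul_nonneg (sub_nonneg.2 hκl) (sq_nonneg (D ω))]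
    have hsq : ∫ ω, (clusterSum (b · ω) (u · ω) f (m + 2) - a * ((m + 2 : ℕ) : ℝ)) ^ 2 ∂P ≤
        (∫ ω, D ω ^ 2 ∂P) + 2 * (∫ ω, D ω * (clusterSum (b · ω) (u · ω) f (m + 2) -
          clusterSum (b · ω) (u · ω) f (m + 1)) ∂P) - 2 * a * (∫ ω, D ω ∂P) + (1 + |a|) ^ 2 := by
      have h1 : ∫ _, (1 + |a|) ^ 2 ∂P = (1 + |a|) ^ 2 := by simp
      have i1 : Integrable (fun ω ↦ D ω ^ 2 + 2 * (D ω * (clusterSum (b · ω) (u · ω) f (m + 2) -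
          clusterSum (b · ω) (u · ω) f (m + 1)))) P := hD2.add (hDinc.const_mul _)
      have i2 : Integrable (fun ω ↦ D ω ^ 2 + 2 * (D ω * (clusterSum (b · ω) (u · ω) f (m + 2) -
          clusterSum (b · ω) (u · ω) f (m + 1))) - 2 * a * D ω) P := i1.sub (hDi.const_mul _)
      rw [← h1, ← integral_const_mul, ← integral_const_mul, ← integral_add hD2 (hDinc.const_mul _),
        ← integral_sub i1 (hDi.const_mul _), ← integral_add i2 (integrable_const _)]
      refine integral_mono
        (h.integrable_clusterSum_comp f (m + 2) fun x ↦ (x - a * ((m + 2 : ℕ) : ℝ)) ^ 2)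
        (i2.add (integrable_const _)) fun ω ↦ ?_
      have hs := hδ (clusterSize (b · ω) (u · ω) (m + 1) (rootIndex (b · ω) (u · ω) (m + 1)))
      have hinc := clusterSum_succ (b · ω) (u · ω) hf (m + 1)
      rw [← sub_eq_iff_eq_add'] at hinc
      rw [← hinc] at hs
      have e' : clusterSum (b · ω) (u · ω) f (m + 1) = D ω + a * (m + 1) := by simp [hD]
      simp only [e'] at hs ⊢
      push_cast at hs ⊢
      refine le_trans (le_of_eq ?_) (add_le_add_right hs _)
      ring
    have hpm : 0 ≤ p / (m + 1) := by positivity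
    have h2 := mul_le_mul_of_nonneg_left hcross hpm
    have h3 := mul_le_mul_of_nonneg_left (hg (m + 1)) hpm
    have h4 : p / (m + 1) * (C * ((m + 1 : ℕ) : ℝ)) = p * C := by
      push_cast
      field_simp
    have h5 : p / (m + 1) * ((m + 1) * (κ * a' - l * a) * ∫ ω, D ω ∂P) =
        p * (κ * a' - l * a) * ∫ ω, D ω ∂P := by
      field_simp
    -- The stationary equation `ha` cancels every term linear in `D`.
    have h6 : 2 * a * ∫ ω, D ω ∂P =
        2 * ((1 - p) * f 1 * ∫ ω, D ω ∂P) + 2 * (p * (κ * a' - l * a) * ∫ ω, D ω ∂P) := by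
      conv_lhs => rw [ha]
      ring
    have ih' : ∫ ω, D ω ^ 2 ∂P ≤ (p * C + (1 + |a|) ^ 2) * (m + 1) := by
      simpa [hD] using ih
    push_cast at *
    rw [mul_add, h5] at h2
    rw [h4] at h3
    have e7 : (m : ℝ) + 1 + 1 = m + 2 := by ring
    rw [e7]
    linarith

end Moments

/-- The ratio `s * ((1 + 1 / s) ^ β - 1)` tends to `β`, the derivative of `(1 + x) ^ β` at `0`, so
it is eventually below `γ`; the constant `C` pays for the finitely many other `s`. -/
lemma exists_rpow_drift_le {β γ : ℝ} (hβ : 0 < β) (hβγ : β < γ) :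
    ∃ C, ∀ s : ℕ, s * (((s + 1 : ℕ) : ℝ) ^ β - (s : ℝ) ^ β) ≤ γ * (s : ℝ) ^ β + C := by
  have hder : HasDerivAt (fun x : ℝ ↦ (1 + x) ^ β) β 0 := by
    have := ((hasDerivAt_id (0 : ℝ)).const_add 1).rpow_const (p := β) (Or.inl (by simp))
    simpa using this
  have hslope : Tendsto (fun s : ℕ ↦ (s : ℝ) * ((1 + 1 / (s : ℝ)) ^ β - 1)) atTop (𝓝 β) := by
    have h0 : Tendsto (fun s : ℕ ↦ 1 / (s : ℝ)) atTop (𝓝[≠] 0) := by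
      refine tendsto_nhdsWithin_iff.2 ⟨tendsto_one_div_atTop_nhds_zero_nat, ?_⟩
      filter_upwards [eventually_gt_atTop 0] with s hs
      have : (s : ℝ) ≠ 0 := by exact_mod_cast hs.ne'
      simpa using hs.ne'
    refine ((hasDerivAt_iff_tendsto_slope.1 hder).comp h0).congr fun s ↦ ?_
    simp [slope_def_field, div_eq_mul_inv, mul_comm]
  obtain ⟨N, hN⟩ := eventually_atTop.1 ((hslope.eventually (eventually_lt_nhds hβγ)).and
    (eventually_gt_atTop 0))
  set F : ℕ → ℝ := fun s ↦ s * (((s + 1 : ℕ) : ℝ) ^ β - (s : ℝ) ^ β) with hF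
  have hγ : 0 < γ := hβ.trans hβγ
  refine ⟨∑ s ∈ Finset.range N, |F s|, fun s ↦ ?_⟩
  rcases lt_or_ge s N with hs | hs
  · have h1 : |F s| ≤ ∑ s ∈ Finset.range N, |F s| :=
      Finset.single_le_sum (f := fun s ↦ |F s|) (fun _ _ ↦ abs_nonneg _) (Finset.mem_range.2 hs)
    have h2 : 0 ≤ γ * (s : ℝ) ^ β := by positivity
    linarith [le_abs_self (F s)]
  · obtain ⟨h1, h2⟩ := hN s hs
    have hs0 : (0 : ℝ) < s := by exact_mod_cast h2
    have h3 : (((s + 1 : ℕ) : ℝ)) ^ β = (s : ℝ) ^ β * (1 + 1 / (s : ℝ)) ^ β := by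
      rw [← Real.mul_rpow hs0.le (by positivity)]
      congr 1
      push_cast
      field_simp
    have h4 : 0 ≤ (s : ℝ) ^ β := by positivity
    have h5 : 0 ≤ ∑ s ∈ Finset.range N, |F s| := Finset.sum_nonneg fun _ _ ↦ abs_nonneg _
    rw [h3]
    nlinarith [mul_le_mul_of_nonneg_left h1.le h4]

/-! ### Laws of large numbers for cluster counts and power sums. -/

section LargeNumbers

variable {d : ℕ} {Ω : Type*} [MeasurableSpace Ω] {P : Measure Ω} {α p : ℝ}
  {ξ : ℕ → Ω → EuclideanSpace ℝ (Fin d)} {b : ℕ → Ω → Bool} {u : (n : ℕ) → Ω → Fin (n + 1)}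

/-- The condition `β * p < 1` leaves room for a drift rate `γ` with `β < γ < 1 / p`. -/
lemma IsSharkDriving.integral_clusterSum_rpow_le [IsProbabilityMeasure P]
    (h : IsSharkDriving P α p ξ b u) (hp : 0 < p) {β : ℝ} (hβ : 0 < β) (hpβ : β * p < 1) :
    ∃ K, ∀ n, ∫ ω, clusterSum (b · ω) (u · ω) (fun s ↦ (s : ℝ) ^ β) n ∂P ≤ K * n := by
  obtain ⟨γ, hβγ, hγ⟩ := exists_between ((lt_div_iff₀ hp).2 hpβ)
  obtain ⟨C, hC⟩ := exists_rpow_drift_le hβ hβγ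
  exact h.integral_clusterSum_le (by simp [hβ.ne']) (hβ.trans hβγ).le
    (by rw [mul_comm]; exact (lt_div_iff₀ hp).1 hγ) hC

/-- A solution `a` of the stationary equations for the density of clusters of size `k + 1`. -/
structure IsClusterDensity (p : ℝ) (a : ℕ → ℝ) : Prop where
  zero : a 0 = 1 - p - p * a 0
  succ : ∀ k : ℕ, a (k + 1) = p * ((k + 1) * a k - (k + 2) * a (k + 1))

variable {a : ℕ → ℝ}

/-- Clusters of size `k + 2` are created from those of size `k + 1` at rate `k + 1` and lost at rate
`k + 2`; thus each count is driven only by the preceding one. -/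
lemma IsSharkDriving.integral_sq_clusterCount_sub_le [IsProbabilityMeasure P]
    (h : IsSharkDriving P α p ξ b u) (ha : IsClusterDensity p a) (k : ℕ) :
    ∃ K, ∀ n : ℕ, ∫ ω, (clusterSum (b · ω) (u · ω) (fun s ↦ if s = k + 1 then 1 else 0) n -
      a k * n) ^ 2 ∂P ≤ K * n := by
  have habs : ∀ k s : ℕ,
      |(if s + 1 = k + 1 then 1 else 0 : ℝ) - if s = k + 1 then 1 else 0| ≤ 1 := by
    intro k s
    split_ifs <;> simp
  induction k with
  | zero =>
    -- No smaller clusters feed those of size one, so the driving term is absent.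
    refine h.integral_sq_clusterSum_sub_le (g := 0) (κ := 0) (l := 1) (a' := 0) (C := 0)
      (by simp) (habs 0) le_rfl zero_le_one (fun s ↦ ?_) ?_ (by simp)
    · rcases s with _ | _ | s <;> simp
    · have := ha.zero
      simp only [zero_add, if_true]
      linarith
  | succ k ih =>
    obtain ⟨K, hK⟩ := ih
    refine h.integral_sq_clusterSum_sub_le (g := fun s ↦ if s = k + 1 then 1 else 0)
      (κ := k + 1) (l := k + 2) (a' := a k) (C := (k + 1) * K)
      (by simp) (habs (k + 1)) (by positivity) (by linarith) (fun s ↦ ?_) ?_ (fun n ↦ ?_)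
    · rcases eq_or_ne s (k + 1) with rfl | h1
      · simp
      · rcases eq_or_ne s (k + 2) with rfl | h2
        · simp
        · simp [h1, h2]
    · simpa using ha.succ k
    · rw [mul_assoc]
      exact mul_le_mul_of_nonneg_left (hK n) (by positivity)

/-- A mean square of order `n` gives a mean absolute error of order `√n`, by `|X| ≤ X ^ 2 / (2 * √n)
+ √n / 2`. -/
lemma IsSharkDriving.tendsto_integral_abs_clusterCount_sub [IsProbabilityMeasure P]
    (h : IsSharkDriving P α p ξ b u) (ha : IsClusterDensity p a) (k : ℕ) :
    Tendsto (fun n : ℕ ↦ (∫ ω, |clusterSum (b · ω) (u · ω) (fun s ↦ if s = k + 1 then 1 else 0) n -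
      a k * n| ∂P) / n) atTop (𝓝 0) := by
  obtain ⟨K, hK⟩ := h.integral_sq_clusterCount_sub_le ha k
  have hlim : Tendsto (fun n : ℕ ↦ (K + 1) / 2 * (1 / √(n : ℝ))) atTop (𝓝 0) := by
    rw [← mul_zero ((K + 1) / 2)]
    refine Tendsto.const_mul _ ?_
    simp_rw [one_div]
    exact tendsto_inv_atTop_zero.comp
      (Real.tendsto_sqrt_atTop.comp tendsto_natCast_atTop_atTop)
  refine squeeze_zero' (Eventually.of_forall fun n ↦
    div_nonneg (integral_nonneg fun _ ↦ abs_nonneg _) n.cast_nonneg) ?_ hlim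
  filter_upwards [eventually_gt_atTop 0] with n hn
  have hn' : (0 : ℝ) < n := by exact_mod_cast hn
  have hs : 0 < √(n : ℝ) := Real.sqrt_pos.2 hn'
  set X : Ω → ℝ := fun ω ↦
    clusterSum (b · ω) (u · ω) (fun s ↦ if s = k + 1 then 1 else 0) n - a k * n with hX
  have i1 : Integrable (fun ω ↦ |X ω|) P := h.integrable_clusterSum_comp _ n fun x ↦ |x - a k * n|
  have i2 : Integrable (fun ω ↦ X ω ^ 2) P :=
    h.integrable_clusterSum_comp _ n fun x ↦ (x - a k * n) ^ 2
  have hle : ∫ ω, |X ω| ∂P ≤ (∫ ω, X ω ^ 2 ∂P) / (2 * √(n : ℝ)) + √(n : ℝ) / 2 := by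
    have h1 : ∫ _, √(n : ℝ) / 2 ∂P = √(n : ℝ) / 2 := by simp
    rw [← h1, ← integral_div, ← integral_add (i2.div_const _) (integrable_const _)]
    refine integral_mono i1 ((i2.div_const _).add (integrable_const _)) fun ω ↦ ?_
    have h2 : X ω ^ 2 / (2 * √(n : ℝ)) + √(n : ℝ) / 2 - |X ω| =
        (|X ω| - √(n : ℝ)) ^ 2 / (2 * √(n : ℝ)) := by
      rw [← sq_abs (X ω)]
      field_simp
      ring
    have h3 : 0 ≤ (|X ω| - √(n : ℝ)) ^ 2 / (2 * √(n : ℝ)) := by positivity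
    simp only
    linarith
  rw [div_le_iff₀ hn']
  refine hle.trans ?_
  have h1 : (∫ ω, X ω ^ 2 ∂P) / (2 * √(n : ℝ)) ≤ K * n / (2 * √(n : ℝ)) :=
    div_le_div_of_nonneg_right (hK n) (by positivity)
  have h2 : (n : ℝ) = √(n : ℝ) * √(n : ℝ) := (Real.mul_self_sqrt hn'.le).symm
  have h3 : K * n / (2 * √(n : ℝ)) = K / 2 * √(n : ℝ) := by
    rw [div_eq_iff (by positivity)]
    linear_combination K * h2
  have h4 : (K + 1) / 2 * (1 / √(n : ℝ)) * n = (K + 1) / 2 * √(n : ℝ) := by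
    field_simp
    linear_combination (K + 1) * h2
  linarith

/-- The part of the cluster sum of `s ^ α` which is due to the clusters of size at most `M`. -/
lemma clusterSum_rpow_truncation (b : ℕ → Bool) (u : (n : ℕ) → Fin (n + 1)) {α β : ℝ} (hα : 0 < α)
    (hαβ : α < β) {M : ℕ} (hM : 0 < M) (n : ℕ) :
    |clusterSum b u (fun s ↦ (s : ℝ) ^ α) n - ∑ k ∈ Finset.range M,
      ((k + 1 : ℕ) : ℝ) ^ α * clusterSum b u (fun s ↦ if s = k + 1 then 1 else 0) n| ≤
      (M : ℝ) ^ (α - β) * clusterSum b u (fun s ↦ (s : ℝ) ^ β) n := by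
  simp_rw [← clusterSum_mul_left]
  simp only [clusterSum]
  rw [Finset.sum_comm, ← Finset.sum_sub_distrib]
  refine (Finset.abs_sum_le_sum_abs _ _).trans (Finset.sum_le_sum fun i _ ↦ ?_)
  generalize clusterSize b u n i = s
  have hM' : (0 : ℝ) < M := by exact_mod_cast hM
  have hnn : 0 ≤ (M : ℝ) ^ (α - β) * (s : ℝ) ^ β := by positivity
  rcases s with _ | s
  · simpa [hα.ne'] using hnn
  by_cases hs : s < M
  · rw [Finset.sum_eq_single_of_mem s (Finset.mem_range.2 hs)
      (fun k _ hk ↦ by simp [hk.symm])]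
    simpa using hnn
  · rw [Finset.sum_eq_zero fun k hk ↦ ?_]
    · have hs0 : (0 : ℝ) < ((s + 1 : ℕ) : ℝ) := by positivity
      rw [sub_zero, abs_of_nonneg (by positivity)]
      -- Here the size exceeds `M`, and the exponent `α - β` is negative.
      calc ((s + 1 : ℕ) : ℝ) ^ α = ((s + 1 : ℕ) : ℝ) ^ (α - β) * ((s + 1 : ℕ) : ℝ) ^ β := by
            rw [← Real.rpow_add hs0, sub_add_cancel]
        _ ≤ _ := by
            refine mul_le_mul_of_nonneg_right ?_ (by positivity)
            refine Real.rpow_le_rpow_of_nonpos hM' ?_ (by linarith)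
            exact_mod_cast (not_lt.1 hs).trans s.le_succ
    · have := Finset.mem_range.1 hk
      rw [if_neg (by omega), mul_zero]

lemma IsSharkDriving.integral_abs_sum_clusterCount_sub_le [IsProbabilityMeasure P]
    (h : IsSharkDriving P α p ξ b u) (w a : ℕ → ℝ) (hw : ∀ k, 0 ≤ w k) (M n : ℕ) :
    ∫ ω, |∑ k ∈ Finset.range M, w k *
        clusterSum (b · ω) (u · ω) (fun s ↦ if s = k + 1 then 1 else 0) n -
        (∑ k ∈ Finset.range M, w k * a k) * n| ∂P ≤
      ∑ k ∈ Finset.range M, w k * ∫ ω, |clusterSum (b · ω) (u · ω)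
        (fun s ↦ if s = k + 1 then 1 else 0) n - a k * n| ∂P := by
  have i1 : ∀ k, Integrable (fun ω ↦ w k * |clusterSum (b · ω) (u · ω)
      (fun s ↦ if s = k + 1 then 1 else 0) n - a k * n|) P :=
    fun k ↦ h.integrable_clusterSum_comp _ n fun x ↦ w k * |x - a k * n|
  simp_rw [← integral_const_mul]
  rw [← integral_finsetSum _ fun k _ ↦ i1 k]
  refine integral_mono (h.integrable_of_clusterSize n fun N ↦ |∑ k ∈ Finset.range M, w k *
    (∑ i ∈ Finset.range n, if N i = k + 1 then 1 else 0) -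
        (∑ k ∈ Finset.range M, w k * a k) * n|) (integrable_finsetSum _ fun k _ ↦ i1 k) fun ω ↦ ?_
  rw [Finset.sum_mul, ← Finset.sum_sub_distrib]
  refine (Finset.abs_sum_le_sum_abs _ _).trans_eq (Finset.sum_congr rfl fun k _ ↦ ?_)
  rw [mul_assoc, ← mul_sub, abs_mul, abs_of_nonneg (hw k)]

lemma IsSharkDriving.tendsto_sum_clusterCount [IsProbabilityMeasure P]
    (h : IsSharkDriving P α p ξ b u) (ha : IsClusterDensity p a) (w : ℕ → ℝ) (M : ℕ) :
    Tendsto (fun n : ℕ ↦ (∑ k ∈ Finset.range M, w k * ∫ ω, |clusterSum (b · ω) (u · ω)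
        (fun s ↦ if s = k + 1 then 1 else 0) n - a k * n| ∂P) / n) atTop (𝓝 0) := by
  simp_rw [Finset.sum_div, mul_div_assoc]
  simpa using tendsto_finsetSum (Finset.range M) fun k _ ↦
    (h.tendsto_integral_abs_clusterCount_sub ha k).const_mul (w k)

/-- The limiting cluster sizes have a finite moment of order `α`. -/
lemma IsSharkDriving.summable_rpow_mul_density [IsProbabilityMeasure P]
    (h : IsSharkDriving P α p ξ b u) (ha : IsClusterDensity p a) (ha₀ : ∀ k, 0 ≤ a k)
    (hp : 0 < p) (hα : 0 < α) (hαp : α * p < 1) :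
    Summable fun k : ℕ ↦ ((k + 1 : ℕ) : ℝ) ^ α * a k := by
  obtain ⟨K, hK⟩ := h.integral_clusterSum_rpow_le hp hα hαp
  -- For fixed `M`, the counts of sizes up to `M` contribute at most the full power sum, whose mean
  -- is at most `K * n`; dividing by `n` and letting `n → ∞` bounds the partial sum by `K`.
  refine summable_of_sum_range_le (c := K) (fun k ↦ mul_nonneg (by positivity) (ha₀ k)) fun M ↦ ?_
  set w : ℕ → ℝ := fun k ↦ ((k + 1 : ℕ) : ℝ) ^ α with hw
  have hlim := (h.tendsto_sum_clusterCount ha w M).const_add K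
  rw [add_zero] at hlim
  refine ge_of_tendsto hlim ?_
  filter_upwards [eventually_gt_atTop 0] with n hn
  have hn' : (0 : ℝ) < n := by exact_mod_cast hn
  have hcount := h.integral_abs_sum_clusterCount_sub_le w a (fun k ↦ by positivity) M n
  refine le_trans ?_ (add_le_add (le_refl K) (div_le_div_of_nonneg_right hcount hn'.le))
  rw [← sub_le_iff_le_add', le_div_iff₀ hn', sub_mul, sub_le_iff_le_add']
  refine le_trans ?_ (add_le_add (hK n) le_rfl)
  have i2 : Integrable (fun ω ↦ |∑ k ∈ Finset.range M, w k *
        clusterSum (b · ω) (u · ω) (fun s ↦ if s = k + 1 then 1 else 0) n -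
        (∑ k ∈ Finset.range M, w k * a k) * n|) P :=
    h.integrable_of_clusterSize n fun N ↦ |∑ k ∈ Finset.range M, w k *
      (∑ i ∈ Finset.range n, if N i = k + 1 then 1 else 0) -
        (∑ k ∈ Finset.range M, w k * a k) * n|
  rw [← integral_add (h.integrable_clusterSum _ n) i2]
  have h1 : ∫ _, (∑ k ∈ Finset.range M, w k * a k) * (n : ℝ) ∂P =
    (∑ k ∈ Finset.range M, w k * a k) * n := by simp
  refine h1.symm.trans_le ?_
  refine integral_mono (integrable_const _) ((h.integrable_clusterSum _ n).add i2) fun ω ↦ ?_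
  have h2 : ∑ k ∈ Finset.range M, w k *
      clusterSum (b · ω) (u · ω) (fun s ↦ if s = k + 1 then 1 else 0) n ≤
      clusterSum (b · ω) (u · ω) (fun s ↦ (s : ℝ) ^ α) n := by
    simp_rw [← clusterSum_mul_left]
    simp only [clusterSum]
    rw [Finset.sum_comm]
    refine Finset.sum_le_sum fun i _ ↦ ?_
    generalize clusterSize (b · ω) (u · ω) n i = s
    rcases s with _ | s
    · simp [hα.ne']
    by_cases hs : s < M
    · rw [Finset.sum_eq_single_of_mem s (Finset.mem_range.2 hs)
        (fun k _ hk ↦ by simp [hk.symm])]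
      simp [hw]
    · rw [Finset.sum_eq_zero fun k hk ↦ ?_]
      · positivity
      · have := Finset.mem_range.1 hk
        rw [if_neg (by omega), mul_zero]
  have h3 := neg_abs_le (∑ k ∈ Finset.range M, w k *
      clusterSum (b · ω) (u · ω) (fun s ↦ if s = k + 1 then 1 else 0) n -
        (∑ k ∈ Finset.range M, w k * a k) * n)
  simp only
  linarith

/-- The law of large numbers for the sum of the powers of the cluster sizes. -/
lemma IsSharkDriving.tendsto_integral_abs_clusterSum_rpow_sub [IsProbabilityMeasure P]
    (h : IsSharkDriving P α p ξ b u) (ha : IsClusterDensity p a) (ha₀ : ∀ k, 0 ≤ a k)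
    (hp : 0 < p) (hα : 0 < α) (hαp : α * p < 1) :
    Tendsto (fun n : ℕ ↦ (∫ ω, |clusterSum (b · ω) (u · ω) (fun s ↦ (s : ℝ) ^ α) n -
      (∑' k : ℕ, ((k + 1 : ℕ) : ℝ) ^ α * a k) * n| ∂P) / n) atTop (𝓝 0) := by
  have hsum := h.summable_rpow_mul_density ha ha₀ hp hα hαp
  set c := ∑' k : ℕ, ((k + 1 : ℕ) : ℝ) ^ α * a k with hc
  set w : ℕ → ℝ := fun k ↦ ((k + 1 : ℕ) : ℝ) ^ α with hw
  obtain ⟨β, hαβ, hβ⟩ := exists_between ((lt_div_iff₀ hp).2 hαp)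
  obtain ⟨K, hK⟩ := h.integral_clusterSum_rpow_le hp (hα.trans hαβ) ((lt_div_iff₀ hp).1 hβ)
  -- Three errors: clusters larger than `M`, fluctuations of the finitely many remaining counts, and
  -- the tail of the series. The first and last are small for large `M` uniformly in `n`, so `M` is
  -- fixed before `n → ∞`.
  have hbound : ∀ M : ℕ, 0 < M → ∀ n : ℕ, 0 < n → (∫ ω, |clusterSum (b · ω) (u · ω)
      (fun s ↦ (s : ℝ) ^ α) n - c * n| ∂P) / n ≤ (M : ℝ) ^ (α - β) * K +
        (∑ k ∈ Finset.range M, w k * ∫ ω, |clusterSum (b · ω) (u · ω)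
          (fun s ↦ if s = k + 1 then 1 else 0) n - a k * n| ∂P) / n +
        |∑ k ∈ Finset.range M, w k * a k - c| := by
    intro M hM n hn
    have hn' : (0 : ℝ) < n := by exact_mod_cast hn
    have hcount := h.integral_abs_sum_clusterCount_sub_le w a (fun k ↦ by positivity) M n
    rw [div_le_iff₀ hn', add_mul, add_mul, div_mul_cancel₀ _ hn'.ne', mul_assoc]
    refine le_trans ?_ (add_le_add (add_le_add (mul_le_mul_of_nonneg_left (hK n) (by positivity))
      hcount) le_rfl)
    have i2 : Integrable (fun ω ↦ |∑ k ∈ Finset.range M, w k *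
          clusterSum (b · ω) (u · ω) (fun s ↦ if s = k + 1 then 1 else 0) n -
          (∑ k ∈ Finset.range M, w k * a k) * n|) P :=
      h.integrable_of_clusterSize n fun N ↦ |∑ k ∈ Finset.range M, w k *
        (∑ i ∈ Finset.range n, if N i = k + 1 then 1 else 0) -
          (∑ k ∈ Finset.range M, w k * a k) * n|
    have i3 : Integrable (fun ω ↦ (M : ℝ) ^ (α - β) *
        clusterSum (b · ω) (u · ω) (fun s ↦ (s : ℝ) ^ β) n + |∑ k ∈ Finset.range M, w k *
          clusterSum (b · ω) (u · ω) (fun s ↦ if s = k + 1 then 1 else 0) n -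
          (∑ k ∈ Finset.range M, w k * a k) * n|) P :=
      ((h.integrable_clusterSum _ n).const_mul _).add i2
    have h1 : ∫ _, |∑ k ∈ Finset.range M, w k * a k - c| * (n : ℝ) ∂P =
      |∑ k ∈ Finset.range M, w k * a k - c| * n := by simp
    rw [← h1, ← integral_const_mul, ← integral_add ((h.integrable_clusterSum _ n).const_mul _) i2,
      ← integral_add i3 (integrable_const _)]
    refine integral_mono (h.integrable_clusterSum_comp _ n fun x ↦ |x - c * n|)
      (i3.add (integrable_const _)) fun ω ↦ ?_
    have h2 := clusterSum_rpow_truncation (b · ω) (u · ω) hα hαβ hM n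
    have h3 : |(∑ k ∈ Finset.range M, w k * a k) * (n : ℝ) - c * n| =
        |∑ k ∈ Finset.range M, w k * a k - c| * n := by
      rw [← sub_mul, abs_mul, abs_of_pos hn']
    simp only
    rw [← h3]
    refine (abs_sub_le _ (∑ k ∈ Finset.range M, w k *
      clusterSum (b · ω) (u · ω) (fun s ↦ if s = k + 1 then 1 else 0) n) _).trans ?_
    rw [add_assoc]
    exact add_le_add h2 (abs_sub_le _ _ _)
  have hM : Tendsto (fun M : ℕ ↦ (M : ℝ) ^ (α - β) * K + |∑ k ∈ Finset.range M, w k * a k - c|)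
      atTop (𝓝 0) := by
    have h1 : Tendsto (fun M : ℕ ↦ (M : ℝ) ^ (α - β)) atTop (𝓝 0) := by
      have := (tendsto_rpow_neg_atTop (sub_pos.2 hαβ)).comp (tendsto_natCast_atTop_atTop (R := ℝ))
      simpa [Function.comp_def] using this
    have h2 : Tendsto (fun M : ℕ ↦ |∑ k ∈ Finset.range M, w k * a k - c|) atTop (𝓝 0) := by
      have := (hsum.hasSum.tendsto_sum_nat.sub_const c).abs
      rwa [sub_self, abs_zero] at this
    simpa using (h1.mul_const K).add h2
  refine tendsto_order.2 ⟨fun x hx ↦ Eventually.of_forall fun n ↦ hx.trans_le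
    (div_nonneg (integral_nonneg fun _ ↦ abs_nonneg _) n.cast_nonneg), fun ε hε ↦ ?_⟩
  obtain ⟨M, hM1, hM2⟩ := ((hM.eventually (eventually_lt_nhds (half_pos hε))).and
    (eventually_gt_atTop 0)).exists
  filter_upwards [(h.tendsto_sum_clusterCount ha w M).eventually (eventually_lt_nhds (half_pos hε)),
    eventually_gt_atTop 0] with n hn1 hn2
  linarith [hbound M hM2 n hn2]

end LargeNumbers

/-! ### The cluster densities as integrals of geometric masses. -/

section ClusterDensity

lemma summable_rpow_mul_geometric (α : ℝ) {r : ℝ} (hr₀ : 0 ≤ r) (hr₁ : r < 1) :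
    Summable fun k : ℕ ↦ ((k + 1 : ℕ) : ℝ) ^ α * r ^ k := by
  obtain ⟨s, hrs, hs⟩ := exists_between hr₁
  have hs₀ : 0 < s := hr₀.trans_lt hrs
  have hsum : Summable fun k : ℕ ↦ (k : ℝ) ^ ⌈α⌉₊ * s ^ k :=
    summable_pow_mul_geometric_of_norm_lt_one _ (by rwa [Real.norm_of_nonneg hs₀.le])
  refine Summable.of_nonneg_of_le (fun k ↦ by positivity) (fun k ↦ ?_)
    (((summable_nat_add_iff 1).2 hsum).mul_left s⁻¹)
  calc ((k + 1 : ℕ) : ℝ) ^ α * r ^ k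
      ≤ ((k + 1 : ℕ) : ℝ) ^ ((⌈α⌉₊ : ℕ) : ℝ) * s ^ k := by
        gcongr
        · exact_mod_cast Nat.le_add_left 1 k
        · exact Nat.le_ceil α
    _ = s⁻¹ * (((k + 1 : ℕ) : ℝ) ^ ⌈α⌉₊ * s ^ (k + 1)) := by
        rw [Real.rpow_natCast, pow_succ]
        field_simp

variable {p : ℝ}

lemma geometricParam_eq (hp₀ : 0 ≤ p) {x : ℝ} (hx : x ∈ Icc 0 (1 - p)) :
    (geometricParam p x : ℝ) = (x / (1 - p)) ^ p := by
  have hr : 0 ≤ 1 - p := hx.1.trans hx.2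
  have h : x / (1 - p) ∈ Icc (0 : ℝ) 1 := ⟨div_nonneg hx.1 hr, div_le_one_of_le₀ hx.2 hr⟩
  rw [geometricParam, Set.projIcc_of_mem _ ⟨Real.rpow_nonneg h.1 _, Real.rpow_le_one h.1 h.2 hp₀⟩]

lemma geometricParam_ne_zero (hp₀ : 0 ≤ p) {x : ℝ} (hx : x ∈ Ioc 0 (1 - p)) :
    geometricParam p x ≠ 0 := by
  have h : (geometricParam p x : ℝ) ≠ 0 := by
    rw [geometricParam_eq hp₀ (Ioc_subset_Icc_self hx)]
    exact (Real.rpow_pos_of_pos (div_pos hx.1 (hx.1.trans_le hx.2)) _).ne'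
  exact fun h0 ↦ h (by rw [h0]; rfl)

lemma integrable_rpow_geometricFromOne (α : ℝ) {q : unitInterval} (hq : q ≠ 0) :
    Integrable (fun k : ℕ ↦ (k : ℝ) ^ α) (geometricFromOne q) := by
  have hq' : 0 < (q : ℝ) := unitInterval.pos_iff_ne_zero.2 hq
  rw [geometricFromOne, integrable_map_measure (measurable_of_countable _).aestronglyMeasurable
    (measurable_of_countable _).aemeasurable, integrable_geometricMeasure_iff hq]
  refine ((summable_rpow_mul_geometric α (r := 1 - q) (by linarith [q.2.2])
    (by linarith)).mul_right (q : ℝ)).congr fun k ↦ ?_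
  rw [Function.comp_apply, Real.norm_of_nonneg (by positivity)]
  ring

/-- The mass at `k + 1` of the geometric law with parameter `(x / (1 - p)) ^ p`. -/
def geometricWeight (p : ℝ) (k : ℕ) (x : ℝ) : ℝ :=
  (1 - (x / (1 - p)) ^ p) ^ k * (x / (1 - p)) ^ p

lemma geometricMoment_eq_tsum (α : ℝ) (hp₀ : 0 ≤ p) {x : ℝ} (hx : x ∈ Ioc 0 (1 - p)) :
    geometricMoment α p x = ∑' k : ℕ, ((k + 1 : ℕ) : ℝ) ^ α * geometricWeight p k x := by
  rw [geometricMoment, geometricFromOne, integral_map (measurable_of_countable _).aemeasurable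
    (measurable_of_countable _).aestronglyMeasurable,
    integral_geometricMeasure (geometricParam_ne_zero hp₀ hx),
    geometricParam_eq hp₀ (Ioc_subset_Icc_self hx)]
  refine tsum_congr fun k ↦ ?_
  rw [geometricWeight, smul_eq_mul, mul_comm]

lemma geometricWeight_nonneg (hp₀ : 0 ≤ p) (k : ℕ) {x : ℝ} (hx : x ∈ Icc 0 (1 - p)) :
    0 ≤ geometricWeight p k x := by
  have h := geometricParam_eq hp₀ hx
  rw [geometricWeight, ← h]
  exact mul_nonneg (pow_nonneg (sub_nonneg.2 (geometricParam p x).2.2) _) (geometricParam p x).2.1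

lemma continuous_geometricWeight (hp₀ : 0 ≤ p) (k : ℕ) : Continuous (geometricWeight p k) := by
  have : Continuous fun x : ℝ ↦ (x / (1 - p)) ^ p :=
    (continuous_id.div_const _).rpow_const fun _ ↦ Or.inr hp₀
  unfold geometricWeight
  fun_prop

/-- The asymptotic number, per step, of clusters of size `k + 1`. -/
def clusterDensity (p : ℝ) (k : ℕ) : ℝ := ∫ x in (0 : ℝ)..(1 - p), geometricWeight p k x

lemma clusterDensity_nonneg (hp₀ : 0 ≤ p) (hp₁ : p ≤ 1) (k : ℕ) : 0 ≤ clusterDensity p k :=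
  intervalIntegral.integral_nonneg (by linarith) fun _ hx ↦ geometricWeight_nonneg hp₀ k hx

/-- With `q = (x / (1 - p)) ^ p` one has `x * q' = p * q`, so the integrand is the derivative of `x
* geometricWeight p k x`. This primitive vanishes at `0`, and `q = 1` at `1 - p`. -/
lemma integral_geometricWeight_recursion (hp₀ : 0 < p) (hp₁ : p < 1) (k : ℕ) :
    ∫ x in (0 : ℝ)..(1 - p), ((1 + p) * geometricWeight p k x - p * (x / (1 - p)) ^ p *
      (k * (1 - (x / (1 - p)) ^ p) ^ (k - 1) * (x / (1 - p)) ^ p)) = (1 - p) * 0 ^ k := by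
  have hr : 0 < 1 - p := by linarith
  have hq : Continuous fun x : ℝ ↦ (x / (1 - p)) ^ p :=
    (continuous_id.div_const _).rpow_const fun _ ↦ Or.inr hp₀.le
  have hw := continuous_geometricWeight hp₀.le k
  have hcont : Continuous fun x : ℝ ↦ x * geometricWeight p k x := by fun_prop
  rw [intervalIntegral.integral_eq_sub_of_hasDerivAt_of_le hr.le hcont.continuousOn (fun x hx ↦ ?_)
    (Continuous.intervalIntegrable (by fun_prop) _ _)]
  · rw [geometricWeight, div_self hr.ne', Real.one_rpow]
    simp
  · have hx0 : 0 < x / (1 - p) := div_pos hx.1 hr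
    have h1 : HasDerivAt (fun x : ℝ ↦ (x / (1 - p)) ^ p) (p * (x / (1 - p)) ^ p / x) x := by
      refine (((hasDerivAt_id' x).div_const (1 - p)).rpow_const (p := p)
        (Or.inl hx0.ne')).congr_deriv ?_
      rw [Real.rpow_sub_one hx0.ne']
      field_simp
    have hx' := hx.1.ne'
    refine ((hasDerivAt_id' x).mul (((h1.const_sub 1).pow k).mul h1)).congr_deriv ?_
    simp only [geometricWeight, Pi.mul_apply, Pi.pow_apply]
    field_simp
    ring

lemma isClusterDensity_clusterDensity (hp₀ : 0 < p) (hp₁ : p < 1) :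
    IsClusterDensity p (clusterDensity p) where
  zero := by
    have h := integral_geometricWeight_recursion hp₀ hp₁ 0
    simp only [CharP.cast_eq_zero, zero_mul, mul_zero, sub_zero, pow_zero, mul_one,
      intervalIntegral.integral_const_mul] at h
    rw [clusterDensity]
    linarith
  succ k := by
    have h := integral_geometricWeight_recursion hp₀ hp₁ (k + 1)
    -- Multiplying the mass at `k + 1` by `q` gives its difference with the mass at `k + 2`.
    have e : ∀ x : ℝ, (1 + p) * geometricWeight p (k + 1) x - p * (x / (1 - p)) ^ p *
        (((k + 1 : ℕ) : ℝ) * (1 - (x / (1 - p)) ^ p) ^ (k + 1 - 1) * (x / (1 - p)) ^ p) =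
        (1 + p * (k + 2)) * geometricWeight p (k + 1) x - p * (k + 1) * geometricWeight p k x := by
      intro x
      simp only [geometricWeight, Nat.add_sub_cancel]
      push_cast
      ring
    have i1 : ∀ (c : ℝ) j,
        IntervalIntegrable (fun x ↦ c * geometricWeight p j x) volume 0 (1 - p) :=
      fun c j ↦
        (Continuous.const_mul (continuous_geometricWeight hp₀.le j) c).intervalIntegrable _ _
    simp_rw [e] at h
    rw [intervalIntegral.integral_sub (i1 _ _) (i1 _ _), intervalIntegral.integral_const_mul,
      intervalIntegral.integral_const_mul, pow_succ, mul_zero, mul_zero] at h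
    rw [clusterDensity, clusterDensity]
    linarith

/-- The terms are nonnegative, so summability of their integrals justifies exchanging sum and
integral. -/
lemma sharkConstant_eq_tsum {α : ℝ} (hp₀ : 0 < p) (hp₁ : p < 1)
    (hsum : Summable fun k : ℕ ↦ ((k + 1 : ℕ) : ℝ) ^ α * clusterDensity p k) :
    sharkConstant α p = ∑' k : ℕ, ((k + 1 : ℕ) : ℝ) ^ α * clusterDensity p k := by
  have hr : 0 ≤ 1 - p := by linarith
  have hi : ∀ k, IntegrableOn (fun x ↦ ((k + 1 : ℕ) : ℝ) ^ α * geometricWeight p k x)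
      (Ioc 0 (1 - p)) := fun k ↦
    (intervalIntegrable_iff_integrableOn_Ioc_of_le hr).1
      ((Continuous.const_mul (continuous_geometricWeight hp₀.le k) _).intervalIntegrable _ _)
  have hint : ∀ k, ∫ x in Ioc 0 (1 - p), ((k + 1 : ℕ) : ℝ) ^ α * geometricWeight p k x =
      ((k + 1 : ℕ) : ℝ) ^ α * clusterDensity p k := fun k ↦ by
    rw [clusterDensity, ← intervalIntegral.integral_const_mul, intervalIntegral.integral_of_le hr]
  rw [sharkConstant, intervalIntegral.integral_of_le hr,
    setIntegral_congr_fun measurableSet_Ioc fun x hx ↦ geometricMoment_eq_tsum α hp₀.le hx,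
    ← integral_tsum_of_summable_integral_norm hi]
  · exact tsum_congr hint
  · refine hsum.congr fun k ↦ ?_
    rw [← hint]
    refine (setIntegral_congr_fun measurableSet_Ioc fun x hx ↦ ?_).symm
    exact Real.norm_of_nonneg (mul_nonneg (by positivity)
      (geometricWeight_nonneg hp₀.le k (Ioc_subset_Icc_self hx)))

lemma sharkConstant_pos {α : ℝ} (hp₀ : 0 < p) (hp₁ : p < 1)
    (hsum : Summable fun k : ℕ ↦ ((k + 1 : ℕ) : ℝ) ^ α * clusterDensity p k) :
    0 < sharkConstant α p := by
  rw [sharkConstant_eq_tsum hp₀ hp₁ hsum]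
  refine hsum.tsum_pos (fun k ↦ mul_nonneg (by positivity)
    (clusterDensity_nonneg hp₀.le hp₁.le k)) 0 ?_
  have h := (isClusterDensity_clusterDensity hp₀ hp₁).zero
  have : 0 < clusterDensity p 0 := by
    by_contra! h0
    nlinarith
  positivity

/-- The integral of a non-integrable function is `0` by convention, whereas `sharkConstant` is
positive. -/
lemma intervalIntegrable_geometricMoment {α : ℝ} (hp₀ : 0 < p) (hp₁ : p < 1)
    (hsum : Summable fun k : ℕ ↦ ((k + 1 : ℕ) : ℝ) ^ α * clusterDensity p k) :
    IntervalIntegrable (geometricMoment α p) volume 0 (1 - p) := by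
  by_contra h
  exact (sharkConstant_pos hp₀ hp₁ hsum).ne' (intervalIntegral.integral_undef h)

end ClusterDensity

/-! ### The characteristic function of the position. -/

section CharacteristicFunction

lemma integral_comp_prodMk_of_indepFun {Ω A B : Type*} [MeasurableSpace Ω] [MeasurableSpace A]
    [MeasurableSpace B] {P : Measure Ω} [IsProbabilityMeasure P] {X : Ω → A} {Y : Ω → B}
    (hX : Measurable X) (hY : Measurable Y) (hXY : IndepFun X Y P) {F : A → B → ℂ}
    (hF : Measurable (Function.uncurry F)) {C : ℝ} (hC : ∀ x y, ‖F x y‖ ≤ C) :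
    ∫ ω, F (X ω) (Y ω) ∂P = ∫ ω, ∫ ω', F (X ω') (Y ω) ∂P ∂P := by
  have := Measure.isProbabilityMeasure_map (μ := P) hX.aemeasurable
  have := Measure.isProbabilityMeasure_map (μ := P) hY.aemeasurable
  have h1 : ∫ ω, F (X ω) (Y ω) ∂P = ∫ z, Function.uncurry F z ∂(P.map fun ω ↦ (X ω, Y ω)) :=
    (integral_map (hX.prodMk hY).aemeasurable hF.aestronglyMeasurable).symm
  have hi : Integrable (Function.uncurry F) ((P.map X).prod (P.map Y)) :=
    Integrable.of_bound hF.aestronglyMeasurable C (Eventually.of_forall fun z ↦ hC z.1 z.2)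
  rw [h1, (indepFun_iff_map_prod_eq_prod_map_map hX.aemeasurable hY.aemeasurable).1 hXY,
    integral_prod_symm _ hi, integral_map hY.aemeasurable
      hi.integral_prod_right.aestronglyMeasurable]
  refine integral_congr_ae (Eventually.of_forall fun ω ↦ ?_)
  exact integral_map hX.aemeasurable (hF.comp (by fun_prop)).aestronglyMeasurable

variable {d : ℕ} {Ω : Type*} [MeasurableSpace Ω] {P : Measure Ω} {α p : ℝ}
  {ξ : ℕ → Ω → EuclideanSpace ℝ (Fin d)} {b : ℕ → Ω → Bool} {u : (n : ℕ) → Ω → Fin (n + 1)}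

lemma IsSharkDriving.charFun_sum_smul [IsProbabilityMeasure P] (h : IsSharkDriving P α p ξ b u)
    (c : ℕ → ℝ) (hc : ∀ i, 0 ≤ c i) (n : ℕ) (θ : EuclideanSpace ℝ (Fin d)) :
    charFun (P.map fun ω ↦ ∑ i ∈ Finset.range n, c i • ξ i ω) θ =
      Complex.exp (-((‖θ‖ ^ α * ∑ i ∈ Finset.range n, c i ^ α : ℝ) : ℂ)) := by
  have hξ := h.measurable_step
  have hind : iIndepFun (fun i ω ↦ c i • ξ i ω) P :=
    h.indep_step.comp (fun i x ↦ c i • x) fun i ↦ by fun_prop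
  have hind' : iIndepFun ((Finset.range n).restrict fun i ω ↦ c i • ξ i ω) P :=
    iIndepFun_iff_finset.1 hind _
  rw [iIndepFun.charFun_map_fun_finsetSum_eq_prod
    (fun i _ ↦ (by fun_prop : Measurable fun ω ↦ c i • ξ i ω).aemeasurable) hind']
  rw [Finset.prod_apply, Finset.mul_sum, Complex.ofReal_sum, ← Finset.sum_neg_distrib,
    Complex.exp_sum]
  refine Finset.prod_congr rfl fun i _ ↦ ?_
  rw [charFun_map_smul_comp (hξ i).aemeasurable, (h.law_step i).charFun_eq, one_mul, norm_smul,
    Real.norm_of_nonneg (hc i), Real.mul_rpow (hc i) (norm_nonneg _), mul_comm]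

lemma IsSharkDriving.measurable_clusterSize (h : IsSharkDriving P α p ξ b u) (n i : ℕ) :
    Measurable fun ω ↦ clusterSize (b · ω) (u · ω) n i :=
  HistoryMeasurable.measurable (m := n)
    (fun _ _ e ↦ congrFun (historyMeasurable_clusterSize n.le_succ e) i)
    h.measurable_memory h.measurable_index

lemma sharkPosition_eq_sum_smul (ξ : ℕ → EuclideanSpace ℝ (Fin d)) (b : ℕ → Bool)
    (u : (n : ℕ) → Fin (n + 1)) (n : ℕ) :
    sharkPosition ξ b u n = ∑ i ∈ Finset.range n, (clusterSize b u n i : ℝ) • ξ i := by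
  simp_rw [sharkPosition_eq_sum_clusterSize, Nat.cast_smul_eq_nsmul]

lemma IsSharkDriving.measurable_sharkPosition (h : IsSharkDriving P α p ξ b u) (n : ℕ) :
    Measurable fun ω ↦ sharkPosition (fun i ↦ ξ i ω) (fun m ↦ b m ω) (fun m ↦ u m ω) n := by
  have hξ := h.measurable_step
  have hN := h.measurable_clusterSize n
  simp_rw [sharkPosition_eq_sum_smul]
  refine Finset.measurable_sum _ fun i _ ↦ ?_
  exact ((measurable_of_countable (Nat.cast : ℕ → ℝ)).comp (hN i)).smul (hξ i)

/-- Given the memory, the position of the swim is a weighted sum of independent stable vectors. -/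
lemma IsSharkDriving.charFun_sharkPosition [IsProbabilityMeasure P]
    (h : IsSharkDriving P α p ξ b u) (n : ℕ) (θ : EuclideanSpace ℝ (Fin d)) :
    charFun (P.map fun ω ↦ sharkPosition (fun i ↦ ξ i ω) (fun m ↦ b m ω) (fun m ↦ u m ω) n) θ =
      ∫ ω, Complex.exp
        (-((‖θ‖ ^ α * clusterSum (b · ω) (u · ω) (fun s ↦ (s : ℝ) ^ α) n : ℝ) : ℂ)) ∂P := by
  have hξ := h.measurable_step
  have hb := h.measurable_memory
  have hu := h.measurable_index
  -- The map `g` reads the sizes off a finite history independent of the fresh steps; freezing that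
  -- history makes the weights deterministic.
  obtain ⟨g, hg⟩ := (historyMeasurable_clusterSize (b := b) (u := u) n.le_succ).exists_eq_comp
  have hg' : ∀ ω i, clusterSize (b · ω) (u · ω) n i = g (sharkHistory b u n ω) i :=
    fun ω i ↦ congrFun (congrFun hg ω) i
  have hind : IndepFun (fun ω i ↦ ξ i ω) (sharkHistory b u n) P :=
    h.indep_step_memory_index.comp (φ := id)
      (ψ := fun x : (ℕ → Bool) × ((n : ℕ) → Fin (n + 1)) ↦
        ((fun i : Finset.range n ↦ x.1 i, fun i : Finset.range n ↦ x.2 i) :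
          (Finset.range n → Bool) × ((i : Finset.range n) → Fin (i + 1))))
      measurable_id (by fun_prop)
  set F : (ℕ → EuclideanSpace ℝ (Fin d)) →
      (Finset.range n → Bool) × ((i : Finset.range n) → Fin (i + 1)) → ℂ :=
    fun x r ↦ Complex.exp (inner ℝ (∑ i ∈ Finset.range n, (g r i : ℝ) • x i) θ * Complex.I) with hF
  have hgm : ∀ i, Measurable fun r ↦ (g r i : ℝ) := fun i ↦ measurable_of_countable _
  have hFm : Measurable (Function.uncurry F) := by
    have : Measurable fun z : (ℕ → EuclideanSpace ℝ (Fin d)) ×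
        ((Finset.range n → Bool) × ((i : Finset.range n) → Fin (i + 1))) ↦
        ∑ i ∈ Finset.range n, (g z.2 i : ℝ) • z.1 i :=
      Finset.measurable_sum _ fun i _ ↦ ((hgm i).comp measurable_snd).smul (by fun_prop)
    simp only [hF, Function.uncurry_def]
    fun_prop
  rw [charFun_apply, integral_map (h.measurable_sharkPosition n).aemeasurable (by fun_prop)]
  have h1 : ∀ ω, Complex.exp (inner ℝ (sharkPosition (fun i ↦ ξ i ω) (fun m ↦ b m ω)
      (fun m ↦ u m ω) n) θ * Complex.I) = F (fun i ↦ ξ i ω) (sharkHistory b u n ω) := by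
    intro ω
    simp only [hF, sharkPosition_eq_sum_smul, hg']
  simp_rw [h1]
  rw [integral_comp_prodMk_of_indepFun (by fun_prop) (measurable_sharkHistory hb hu n) hind hFm
    (C := 1) fun x r ↦ by rw [Complex.norm_exp_ofReal_mul_I]]
  refine integral_congr_ae (Eventually.of_forall fun ω ↦ ?_)
  simp only [clusterSum, hg']
  rw [← h.charFun_sum_smul (fun i ↦ (g (sharkHistory b u n ω) i : ℝ)) (fun i ↦ by positivity) n θ,
    charFun_apply, integral_map (by fun_prop) (by fun_prop)]

end CharacteristicFunction

lemma abs_exp_neg_sub_exp_neg_le {x y : ℝ} (hx : 0 ≤ x) (hy : 0 ≤ y) :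
    |Real.exp (-x) - Real.exp (-y)| ≤ |x - y| := by
  wlog hxy : x ≤ y generalizing x y
  · rw [abs_sub_comm, abs_sub_comm x]
    exact this hy hx (le_of_not_ge hxy)
  have h1 : Real.exp (-y) = Real.exp (-x) * Real.exp (x - y) := by
    rw [← Real.exp_add]
    congr 1
    ring
  have h2 := Real.add_one_le_exp (x - y)
  have h3 : Real.exp (-x) ≤ 1 := Real.exp_le_one_iff.2 (by linarith)
  have h4 : Real.exp (-y) ≤ Real.exp (-x) := Real.exp_le_exp.2 (by linarith)
  rw [abs_of_nonneg (by linarith), abs_of_nonpos (by linarith), h1]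
  nlinarith [Real.exp_pos (-x)]

/-- Write `e m / n = (e m / m) * (m / n)` with `m / n → t`. For `t = 0` the index stays at `0`,
which is where `e 0 = 0` enters. -/
lemma tendsto_floor_div {e : ℕ → ℝ} (he₀ : e 0 = 0) (he : Tendsto (fun n ↦ e n / n) atTop (𝓝 0))
    {t : ℝ} (ht : 0 ≤ t) : Tendsto (fun n : ℕ ↦ e ⌊t * n⌋₊ / n) atTop (𝓝 0) := by
  rcases ht.eq_or_lt with rfl | ht
  · simp [he₀]
  have h1 : Tendsto (fun n : ℕ ↦ ⌊t * (n : ℝ)⌋₊) atTop atTop :=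
    tendsto_nat_floor_atTop.comp (tendsto_natCast_atTop_atTop.const_mul_atTop ht)
  have h2 : Tendsto (fun n : ℕ ↦ (⌊t * (n : ℝ)⌋₊ : ℝ) / n) atTop (𝓝 t) :=
    (tendsto_nat_floor_mul_div_atTop ht.le).comp tendsto_natCast_atTop_atTop
  have h3 := (he.comp h1).mul h2
  rw [zero_mul] at h3
  refine h3.congr fun n ↦ ?_
  rcases eq_or_ne ⌊t * (n : ℝ)⌋₊ 0 with h0 | h0
  · simp [h0, he₀]
  · have : (⌊t * (n : ℝ)⌋₊ : ℝ) ≠ 0 := by exact_mod_cast h0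
    simp only [Function.comp_apply]
    field_simp

/-! ### Passage to the limit. -/

section Convergence

variable {d : ℕ} {Ω : Type*} [MeasurableSpace Ω] {P : Measure Ω} {α p : ℝ}
  {ξ : ℕ → Ω → EuclideanSpace ℝ (Fin d)} {b : ℕ → Ω → Bool} {u : (n : ℕ) → Ω → Fin (n + 1)}

lemma IsSharkDriving.tendsto_integral_exp_clusterSum [IsProbabilityMeasure P]
    (h : IsSharkDriving P α p ξ b u) {c : ℝ} (hc : 0 ≤ c)
    (hlim : Tendsto (fun n : ℕ ↦ (∫ ω, |clusterSum (b · ω) (u · ω) (fun s ↦ (s : ℝ) ^ α) n -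
      c * n| ∂P) / n) atTop (𝓝 0)) {t : ℝ} (ht : 0 ≤ t) {l : ℝ} (hl : 0 ≤ l) :
    Tendsto (fun n : ℕ ↦ ∫ ω, Complex.exp (-((1 / (n : ℝ) * l *
      clusterSum (b · ω) (u · ω) (fun s ↦ (s : ℝ) ^ α) ⌊t * (n : ℝ)⌋₊ : ℝ) : ℂ)) ∂P) atTop
      (𝓝 (Complex.exp (-((c * (t * l) : ℝ) : ℂ)))) := by
  set X : ℕ → Ω → ℝ := fun n ω ↦ clusterSum (b · ω) (u · ω) (fun s ↦ (s : ℝ) ^ α) n with hX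
  have hX₀ : ∀ n ω, 0 ≤ X n ω := fun n ω ↦ clusterSum_nonneg _ _ (fun k ↦ by positivity) n
  have h1 := tendsto_floor_div (e := fun n ↦ ∫ ω, |X n ω - c * n| ∂P)
    (by simp [hX, clusterSum_zero]) hlim ht
  have h2 : Tendsto (fun n : ℕ ↦ c * |(⌊t * (n : ℝ)⌋₊ : ℝ) / n - t|) atTop (𝓝 0) := by
    have := ((((tendsto_nat_floor_mul_div_atTop ht).comp
      tendsto_natCast_atTop_atTop).sub_const t).abs).const_mul c
    simpa [Function.comp_def] using this
  have h3 := (h1.add h2).const_mul l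
  rw [add_zero, mul_zero] at h3
  have hre : ∀ n, ∫ ω, Complex.exp (-((1 / (n : ℝ) * l * X ⌊t * (n : ℝ)⌋₊ ω : ℝ) : ℂ)) ∂P =
      ((∫ ω, Real.exp (-(1 / (n : ℝ) * l * X ⌊t * (n : ℝ)⌋₊ ω)) ∂P : ℝ) : ℂ) := by
    intro n
    rw [← integral_complex_ofReal]
    refine integral_congr_ae (Eventually.of_forall fun ω ↦ ?_)
    simp only [Complex.ofReal_exp, Complex.ofReal_neg]
  refine Tendsto.congr (fun n ↦ (hre n).symm) ?_
  rw [← Complex.ofReal_neg, ← Complex.ofReal_exp]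
  refine (Complex.continuous_ofReal.tendsto _).comp (tendsto_iff_dist_tendsto_zero.2 ?_)
  refine squeeze_zero' (Eventually.of_forall fun _ ↦ dist_nonneg) ?_ h3
  filter_upwards [eventually_gt_atTop 0] with n hn
  have hn' : (0 : ℝ) < n := by exact_mod_cast hn
  set m := ⌊t * (n : ℝ)⌋₊ with hm
  have i1 : Integrable (fun ω ↦ Real.exp (-(1 / (n : ℝ) * l * X m ω))) P :=
    h.integrable_clusterSum_comp _ m fun x ↦ Real.exp (-(1 / (n : ℝ) * l * x))
  have i2 : Integrable (fun ω ↦ |X m ω - c * m|) P :=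
    h.integrable_clusterSum_comp _ m fun x ↦ |x - c * m|
  have i3 : Integrable (fun ω ↦ l * (|X m ω - c * m| / n + c * |(m : ℝ) / n - t|)) P :=
    ((i2.div_const _).add (integrable_const _)).const_mul _
  have e1 : Real.exp (-(c * (t * l))) = ∫ _, Real.exp (-(c * (t * l))) ∂P := by simp
  have e2 : l * ((∫ ω, |X m ω - c * m| ∂P) / n + c * |(m : ℝ) / n - t|) =
      ∫ ω, l * (|X m ω - c * m| / n + c * |(m : ℝ) / n - t|) ∂P := by
    rw [integral_const_mul, integral_add (i2.div_const _) (integrable_const _), integral_div]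
    simp
  rw [Real.dist_eq, e1, ← integral_sub i1 (integrable_const _), e2]
  refine abs_integral_le_integral_abs.trans (integral_mono (i1.sub (integrable_const _)).abs i3
    fun ω ↦ ?_)
  refine (abs_exp_neg_sub_exp_neg_le (mul_nonneg (by positivity) (hX₀ m ω))
    (by positivity)).trans ?_
  -- The error splits into the fluctuation at time `m` and the rounding of `t` to `m / n`.
  have e3 : 1 / (n : ℝ) * l * X m ω - c * (t * l) =
      l * ((X m ω - c * m) / n + c * ((m : ℝ) / n - t)) := by
    field_simp
    ring
  rw [e3, abs_mul, abs_of_nonneg hl]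
  refine mul_le_mul_of_nonneg_left ((abs_add_le _ _).trans_eq ?_) hl
  rw [abs_div, abs_of_pos hn', abs_mul, abs_of_nonneg hc]

lemma IsIsotropicStable.map_smul {μ : Measure (EuclideanSpace ℝ (Fin d))} {σ r : ℝ}
    (h : IsIsotropicStable α σ μ) (hr : 0 ≤ r) :
    IsIsotropicStable α (σ * r) (μ.map (r • ·)) where
  isProbabilityMeasure := by
    have := h.isProbabilityMeasure
    exact Measure.isProbabilityMeasure_map (by fun_prop)
  charFun_eq θ := by
    rw [charFun_map_smul, h.charFun_eq, norm_smul, Real.norm_of_nonneg hr, mul_assoc]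

end Convergence

end

theorem theorem2 {d : ℕ} {α p : ℝ} (hα₀ : 0 < α) (hα₂ : α ≤ 2) (hp₀ : 0 < p) (hp₁ : p < 1)
    (hαp : α * p < 1)
    {Ω : Type*} [MeasurableSpace Ω] (P : Measure Ω) [IsProbabilityMeasure P]
    (ξ : ℕ → Ω → EuclideanSpace ℝ (Fin d)) (b : ℕ → Ω → Bool) (u : (n : ℕ) → Ω → Fin (n + 1))
    (hswim : IsSharkDriving P α p ξ b u) (t : ℝ) (ht : 0 ≤ t) :
    -- the constant `c(α, p)` is well defined and finite
    (∀ x ∈ Ioo 0 (1 - p),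
      Integrable (fun k : ℕ ↦ (k : ℝ) ^ α) (geometricFromOne (geometricParam p x))) ∧
    IntervalIntegrable (geometricMoment α p) volume 0 (1 - p) ∧
    -- the limit law exists, and the rescaled positions converge to it in distribution
    (∃ ν : Measure (EuclideanSpace ℝ (Fin d)),
      IsIsotropicStable α (sharkConstant α p ^ (1 / α)) ν) ∧
    ∀ {Ω' : Type*} [MeasurableSpace Ω'] (P' : Measure Ω') [IsProbabilityMeasure P']
      (S : Ω' → EuclideanSpace ℝ (Fin d)), AEMeasurable S P' →
      IsIsotropicStable α (sharkConstant α p ^ (1 / α)) (P'.map S) →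
      TendstoInDistribution
        (fun (n : ℕ) (ω : Ω) ↦ (1 / (n : ℝ)) ^ (1 / α) •
          sharkPosition (fun i ↦ ξ i ω) (fun m ↦ b m ω) (fun m ↦ u m ω) ⌊t * (n : ℝ)⌋₊)
        atTop (fun ω' ↦ t ^ (1 / α) • S ω') (fun _ ↦ P) P' := by
  have hdens := isClusterDensity_clusterDensity hp₀ hp₁
  have hnn := clusterDensity_nonneg hp₀.le hp₁.le
  have hsum := hswim.summable_rpow_mul_density hdens hnn hp₀ hα₀ hαp
  have hlim := hswim.tendsto_integral_abs_clusterSum_rpow_sub hdens hnn hp₀ hα₀ hαp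
  rw [← sharkConstant_eq_tsum hp₀ hp₁ hsum] at hlim
  have hc := (sharkConstant_pos hp₀ hp₁ hsum).le
  have hroot : ∀ {x y : ℝ}, 0 ≤ x → 0 ≤ y → (x ^ (1 / α) * y) ^ α = x * y ^ α := by
    intro x y hx hy
    rw [Real.mul_rpow (by positivity) hy, ← Real.rpow_mul hx, one_div_mul_cancel hα₀.ne',
      Real.rpow_one]
  refine ⟨fun x hx ↦ integrable_rpow_geometricFromOne α
      (geometricParam_ne_zero hp₀.le (Ioo_subset_Ioc_self hx)),
    intervalIntegrable_geometricMoment hp₀ hp₁ hsum,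
    -- The limit law is realised by rescaling a standard fresh step.
    ⟨(P.map (ξ 0)).map (sharkConstant α p ^ (1 / α) • ·), ?_⟩, ?_⟩
  · simpa using (hswim.law_step 0).map_smul (r := sharkConstant α p ^ (1 / α)) (by positivity)
  intro Ω' _ P' _ S hS hlaw
  have hpos := hswim.measurable_sharkPosition
  refine ⟨fun n ↦ ((hpos ⌊t * (n : ℝ)⌋₊).const_smul ((1 / (n : ℝ)) ^ (1 / α))).aemeasurable,
    by fun_prop, ?_⟩
  -- Lévy's continuity theorem reduces the claim to pointwise convergence of characteristic
  -- functions.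
  refine ProbabilityMeasure.tendsto_iff_tendsto_charFun.2 fun θ ↦ ?_
  have e1 : charFun (P'.map fun ω' ↦ t ^ (1 / α) • S ω') θ =
      Complex.exp (-((sharkConstant α p * (t * ‖θ‖ ^ α) : ℝ) : ℂ)) := by
    rw [charFun_map_smul_comp hS, hlaw.charFun_eq, norm_smul, Real.norm_of_nonneg (by positivity),
      hroot hc (by positivity), hroot ht (norm_nonneg θ)]
  have e2 : ∀ n : ℕ, charFun (P.map fun ω ↦ (1 / (n : ℝ)) ^ (1 / α) •
      sharkPosition (fun i ↦ ξ i ω) (fun m ↦ b m ω) (fun m ↦ u m ω) ⌊t * (n : ℝ)⌋₊) θ =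
      ∫ ω, Complex.exp (-((1 / (n : ℝ) * ‖θ‖ ^ α * clusterSum (b · ω) (u · ω)
        (fun s ↦ (s : ℝ) ^ α) ⌊t * (n : ℝ)⌋₊ : ℝ) : ℂ)) ∂P := by
    intro n
    rw [charFun_map_smul_comp (hpos _).aemeasurable, hswim.charFun_sharkPosition, norm_smul,
      Real.norm_of_nonneg (by positivity), hroot (by positivity) (norm_nonneg θ)]
  simp only [ProbabilityMeasure.coe_mk, e1, e2]
  exact hswim.tendsto_integral_exp_clusterSum hc hlim ht (by positivity)
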